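/- **Setting (dilute $A_5$ model, regime 2).** Let $\lambda=\frac{7\pi}{24}$, $P=\frac{24}{7}$, let $N$ be an even natural number, $u\in\mathbb R$, $\ell\in\mathbb Z$, $w=e^{i\pi\ell/6}$, and $h[x]=\vartheta_1(i\lambda x)$, where $\vartheta_1$ is the Jacobi theta function of nome $e^{i\pi\tau}$, $\operatorname{Im}\tau>0$. For a function $f$ write $f(x\pm ia):=f(x+ia)f(x-ia)$. For $x_1,\dots,x_N\in\mathbb C$ put $$Q(x)=\prod_{j=1}^N h[x-x_j],\qquad \phi(x)=\Bigl(\frac{h[x+(\frac32-u)i]\,h[x-(\frac32-u)i]}{h[2i]\,h[3i]}\Bigr)^{N/2}.$$ The $x_j$ are assumed to satisfy the Bethe ansatz equations $$w\,\phi(x_j+i)\,Q(x_j+i)\,Q(x_j-2i)=-\phi(x_j-i)\,Q(x_j-i)\,Q(x_j+2i),\qquad j=1,\dots,N.$$ Define the boxes $$\boxed{1}_x=w\,\phi(x+\tfrac32i)\phi(x+\tfrac12i)\frac{Q(x-\frac52i)}{Q(x-\frac12i)},\qquad \boxed{2}_x=\phi(x\pm\tfrac32i)\frac{Q(x\pm\frac32i)}{Q(x\pm\frac12i)},\qquad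 \boxed{3}_x=w^{-1}\phi(x-\tfrac32i)\phi(x-\tfrac12i)\frac{Q(x+\frac52i)}{Q(x+\frac12i)},$$ the factors $f_m(x)=\prod_{j=1}^{m-1}\phi\bigl(x\pm i(\tfrac{2m-1}2-j)\bigr)$, and the quantum transfer matrix eigenvalues $$T_m(x)=\frac1{f_m(x)}\sum_{1\le i_1\le\dots\le i_m\le3}\ \prod_{k=1}^m\boxed{i_k}_{\,x+i(2k-m-1)}\quad(m\ge1),\qquad T_0=f_2,\qquad T_m=0\quad(m<0).$$ All identities between such functions are identities of meromorphic functions of $x\in\mathbb C$. Assume the duality $$T_m(x)=T_{9-m}\bigl(x+\tfrac P2i\bigr),\qquad m=0,\dots,10.$$ For a skew diagram $\mu/\nu$ with $r$ rows let $$\Lambda_{\mu/\nu}(x)=\det_{1\le j,k\le r}\Bigl(\widetilde T_{\mu_j-\nu_k-j+k}\bigl(x+i(r-\mu_1+\mu_j+\nu_k-j-k+1)\bigr)\Bigr),\qquad \widetilde T_m=T_m\ (m<10),\quad \widetilde T_m=0\ (m\ge10),$$ and put $T_{B_2}=T_7$ and $$T_{B_3}(x)=\frac{\Lambda_{(8,1)}(x+\frac{13}{14}i)}{\phi(x-\frac{12}7i)},\quad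 T_{B_5}(x)=\frac{\Lambda_{(15,8,8)/(7,7)}(x)}{\phi(x\pm\frac32i)},\quad T_{B_7}(x)=\frac{\Lambda_{(15,15,8,8)/(14,7,7)}(x+\frac{11}{14}i)}{\phi(x-\frac{12}7i)\,\phi(x\pm\frac97i)},\quad T^{(6)}(x)=\Lambda_{(8,7)/(6)}(x+\tfrac{25}{14}i).$$ **$D_4$ related $T$-system.** Number the nodes of the $D_4$ Dynkin diagram so that $3$ is the central node, joined to $1,2,4$, and write $a\sim b$ for adjacent nodes. For functions $t^{(a)}_m$, $g^{(a)}_m$ ($a=1,\dots,4$) with $t^{(a)}_0=1$ consider $$t^{(a)}_m\bigl(x\pm\tfrac i{14}\bigr)=t^{(a)}_{m-1}(x)\,t^{(a)}_{m+1}(x)+g^{(a)}_m(x)\prod_{b\sim a}t^{(b)}_m(x)\qquad(a=1,\dots,4,\ m=1,2),\tag{$*$}$$ where $g^{(a)}_1(x\pm\frac i{14})=g^{(a)}_2(x)$, with the truncation $t^{(3)}_3=t^{(4)}_3=0$, $g^{(3)}_1=g^{(4)}_1=1$, and the gluing conditions $$t^{(1)}_3(x)=t^{(3)}_2(x),\quad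 t^{(2)}_3(x)=t^{(3)}_2(x)\,T_{B_3}(x),\quad g^{(1)}_1(x)=T_0(x),\quad g^{(2)}_1(x)=T_0\bigl(x\pm\tfrac{2i}7\bigr).$$ **Claim.** This system has the solution $$\begin{aligned} t^{(1)}_1(x)&=T^{(6)}(x), & t^{(2)}_1(x)&=T_{B_7}(x),\\ t^{(3)}_1(x)&=\Lambda_{(12,8,7)/(5,4)}(x), & t^{(4)}_1(x)&=\frac{\Lambda_{(5,1)}(x+\frac{15}{14}i)}{\phi(x-\frac{13}2i+\frac{15}{14}i)},\\ t^{(1)}_2(x)&=T_{B_5}(x)\,T_{B_2}(x\pm\tfrac i7), & t^{(2)}_2(x)&=T_{B_5}(x\pm\tfrac i7)\,T_{B_2}(x),\\ t^{(3)}_2(x)&=T_{B_5}(x\pm\tfrac i{14})\,T_{B_2}(x\pm\tfrac i{14}), & t^{(4)}_2(x)&=T_{B_5}(x)\,T_{B_2}(x). \end{aligned}$$ -/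

import Mathlib

open Complex Filter

noncomputable section

namespace DiluteA5

/-- The Jacobi theta function `ϑ₁(z)` with elliptic nome `exp (π i τ)`, through Mathlib's
two-variable theta function; `hasSum_theta₁` below gives its usual series. -/
def theta₁ (τ z : ℂ) : ℂ :=
  -I * exp (Real.pi * I * τ / 4 + I * z) * jacobiTheta₂ (z / Real.pi + (1 + τ) / 2) τ

/-- The parameters of an eigenvalue of the quantum transfer matrix of the dilute `A₅` model:
the Trotter number `N`, the modulus `τ` of the elliptic nome, the spectral parameter `u`,
the label `ℓ` of the sector, and the Bethe roots. -/
structure Data where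
  N : ℕ
  τ : ℂ
  u : ℝ
  ell : ℤ
  root : Fin N → ℂ

/-- The crossing parameter `λ = π (L + 2) / (4 (L + 1))` of regime 2, for `L = 5`. -/
def crossing : ℝ := 7 * Real.pi / 24

/-- The period `P = 4 (L + 1) / (L + 2)` of regime 2, for `L = 5`. -/
def period : ℂ := 24 / 7

/-- `f (x ± i a)` stands for the product `f (x + i a) f (x - i a)`. -/
def pm (f : ℂ → ℂ) (x a : ℂ) : ℂ := f (x + I * a) * f (x - I * a)

namespace Data

variable (D : Data)

/-- `h[x] = ϑ₁ (i λ x)`. -/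
def h (x : ℂ) : ℂ := theta₁ D.τ (I * crossing * x)

def φ (x : ℂ) : ℂ := (pm D.h x (3 / 2 - D.u) / (D.h (2 * I) * D.h (3 * I))) ^ (D.N / 2)

def Q (x : ℂ) : ℂ := ∏ j, D.h (x - D.root j)

/-- `w = exp (i π ℓ / (L + 1))`, for `L = 5`. -/
def w : ℂ := exp (I * Real.pi * D.ell / 6)

/-- The Bethe ansatz equations, multiplied out. -/
def IsBethe : Prop :=
  ∀ j, D.w * D.φ (D.root j + I) * (D.Q (D.root j + I) * D.Q (D.root j - 2 * I)) =
    -(D.φ (D.root j - I) * (D.Q (D.root j - I) * D.Q (D.root j + 2 * I)))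

/-- The boxes with letters `1`, `2`, `3` (here `0`, `1`, `2`) and spectral parameter `x`. -/
def box (l : Fin 3) (x : ℂ) : ℂ :=
  ![D.w * D.φ (x + 3 / 2 * I) * D.φ (x + 1 / 2 * I) *
      (D.Q (x - 5 / 2 * I) / D.Q (x - 1 / 2 * I)),
    D.φ (x + 3 / 2 * I) * D.φ (x - 3 / 2 * I) *
      (D.Q (x - 3 / 2 * I) * D.Q (x + 3 / 2 * I) / (D.Q (x - 1 / 2 * I) * D.Q (x + 1 / 2 * I))),
    D.w⁻¹ * D.φ (x - 3 / 2 * I) * D.φ (x - 1 / 2 * I) *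
      (D.Q (x + 5 / 2 * I) / D.Q (x + 1 / 2 * I))] l

/-- The renormalization factor `f_m(x) = ∏_{j=1}^{m-1} φ (x ± i ((2m-1)/2 - j))`. -/
def f (m : ℕ) (x : ℂ) : ℂ :=
  ∏ j ∈ Finset.Icc 1 (m - 1), pm D.φ x ((2 * (m : ℂ) - 1) / 2 - (j : ℂ))

open Classical in
/-- The sum over the semi-standard tableaux of the `1 × m` diagram; the spectral parameter grows
by `2 i` from each box to the next, from `x - i (m - 1)` to `x + i (m - 1)`. -/
def rowSum (m : ℕ) (x : ℂ) : ℂ :=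
  ∑ l : Fin m → Fin 3 with Monotone l,
    ∏ k : Fin m, D.box (l k) (x + I * (2 * (k : ℂ) - (m : ℂ) + 1))

/-- The renormalized `1 × m` fusion quantum transfer matrix `T_m(x)`, with `T_0 = f_2` and
`T_m = 0` for negative `m`. -/
def T : ℤ → ℂ → ℂ
  | .ofNat 0 => D.f 2
  | .ofNat (m + 1) => fun x => D.rowSum (m + 1) x / D.f (m + 1) x
  | .negSucc _ => 0

/-- The duality `T_m(x) = T_{2L-1-m}(x + i P/2)`, `m = 0, …, 2L`, for `L = 5`, as an equality of
meromorphic functions. -/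
def IsDual : Prop :=
  ∀ m : ℤ, 0 ≤ m → m ≤ 10 →
    D.T m =ᶠ[codiscrete ℂ] fun x => D.T (9 - m) (x + I * (period / 2))

/-- `T_m` with the replacement `T_{m ≥ 2L} → 0`, for `L = 5`. -/
def Ttrunc (m : ℤ) (x : ℂ) : ℂ := if 10 ≤ m then 0 else D.T m x

/-- `Λ_{μ/ν}(x)` for a skew diagram with `n + 1` rows: the quantum Jacobi-Trudi determinant of
the `T_{μ_j - ν_k - j + k} (x + i (μ'_1 - μ_1 + μ_j + ν_k - j - k + 1))`, where `μ'_1 = n + 1`,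
with all `T_{m ≥ 2L}` replaced by zero. Rows and columns are numbered from `1` in this formula
and from `0` in the code. -/
def Lam {n : ℕ} (μ ν : Fin (n + 1) → ℤ) (x : ℂ) : ℂ :=
  Matrix.det (Matrix.of fun j k : Fin (n + 1) =>
    D.Ttrunc (μ j - ν k - ((j : ℕ) : ℤ) + ((k : ℕ) : ℤ))
      (x + I * (((n : ℤ) + 1 - μ 0 + μ j + ν k
        - (((j : ℕ) : ℤ) + 1) - (((k : ℕ) : ℤ) + 1) + 1 : ℤ) : ℂ)))

def T0 : ℂ → ℂ := D.T 0

def TB2 : ℂ → ℂ := D.T 7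

def TB3 (x : ℂ) : ℂ := D.Lam ![8, 1] ![0, 0] (x + 13 / 14 * I) / D.φ (x - 12 / 7 * I)

def TB5 (x : ℂ) : ℂ := D.Lam ![15, 8, 8] ![7, 7, 0] x / pm D.φ x (3 / 2)

def TB7 (x : ℂ) : ℂ :=
  D.Lam ![15, 15, 8, 8] ![14, 7, 7, 0] (x + 11 / 14 * I) /
    (D.φ (x - 12 / 7 * I) * pm D.φ x (9 / 7))

def T6 (x : ℂ) : ℂ := D.Lam ![8, 7] ![6, 0] (x + 25 / 14 * I)

end Data

/-- The nodes of the `D₄` Dynkin diagram; `n3` is the central one. -/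
inductive Node
  | n1 | n2 | n3 | n4
  deriving DecidableEq

instance : Fintype Node := ⟨{.n1, .n2, .n3, .n4}, by rintro (_ | _ | _ | _) <;> simp⟩

/-- Adjacency on the `D₄` Dynkin diagram. -/
def Node.Adj (a b : Node) : Prop := a ≠ b ∧ (a = .n3 ∨ b = .n3)

instance : DecidableRel Node.Adj := fun a b => by unfold Node.Adj; infer_instance

/-- The truncated and glued `D₄` related `T`-system for families `t a m` and `g a m`
(that is, `t^{(a)}_m` and `g^{(a)}_m`), given the functions `T₀` and `T_{B₃}`. Equations between
meromorphic functions of `x` hold off a discrete closed set. -/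
structure IsD4System (T0 TB3 : ℂ → ℂ) (t g : Node → ℕ → ℂ → ℂ) : Prop where
  zero : ∀ a, t a 0 = 1
  tsystem : ∀ a m, m = 1 ∨ m = 2 →
    (fun x => pm (t a m) x (1 / 14)) =ᶠ[codiscrete ℂ] fun x =>
      t a (m - 1) x * t a (m + 1) x + g a m x * ∏ b with Node.Adj b a, t b m x
  g_two : ∀ a x, pm (g a 1) x (1 / 14) = g a 2 x
  truncation_three : t .n3 3 = 0
  truncation_four : t .n4 3 = 0
  g_three : g .n3 1 = 1
  g_four : g .n4 1 = 1
  glue_t_one : t .n1 3 = t .n3 2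
  glue_t_two : ∀ x, t .n2 3 x = t .n3 2 x * TB3 x
  glue_g_one : g .n1 1 = T0
  glue_g_two : ∀ x, g .n2 1 x = pm T0 x (2 / 7)

/-- `ϑ₁(z) = -i ∑_{n ∈ ℤ} (-1)^n q^{(n + 1/2)²} e^{(2n + 1) i z}` with `q = e^{π i τ}`. -/
theorem hasSum_theta₁ {τ : ℂ} (hτ : 0 < τ.im) (z : ℂ) :
    HasSum (fun n : ℤ => -I * ((-1) ^ n * exp (Real.pi * I * τ * ((n : ℂ) + 1 / 2) ^ 2) *
      exp ((2 * (n : ℂ) + 1) * I * z))) (theta₁ τ z) := by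
  have hpi : (Real.pi : ℂ) ≠ 0 := by exact_mod_cast Real.pi_ne_zero
  have h := (hasSum_jacobiTheta₂_term (z / Real.pi + (1 + τ) / 2) hτ).mul_left
    (-I * exp (Real.pi * I * τ / 4 + I * z))
  refine Eq.mp (congrArg (fun F => HasSum F (theta₁ τ z)) (funext fun n => ?_)) h
  symm
  have hm : ((-1 : ℂ)) ^ n = exp (Real.pi * I * n) := by
    rw [← exp_pi_mul_I, ← exp_int_mul]; congr 1; ring
  rw [jacobiTheta₂_term, hm, mul_assoc (-I), ← exp_add, ← exp_add, ← exp_add]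
  congr 2
  field_simp
  ring

end DiluteA5

end

/-! On the lattice x + (i/14)ℤ the period is 48 steps, duality is a shift by 24, and everything
reduces to algebra in three-dimensional space. Cutting rows at their right end gives a third-order
linear recursion for row sums (`wordSum_add_three`) whose coefficients are sums over columns of
heights one, two and three. Height two is T_1 times vacuum factors (`column_two`) and height three
is a product of vacuum factors (`column_three`), so the difference equation is self-adjoint up to
those factors. Its solutions and adjoint solutions therefore interleave into one sequence of vectors
w_n, spaced by i, in which w_n × w_{n+2} is a multiple of w_{n+1} and w_n · w_{n+2m+3} is T_m at the
midpoint (`exists_isVec`).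

Duality lets a scalar product be read as T_m or as T_{9-m}. The functions of the solution become
vector expressions: B5 is (w_1 × w_5) · (w_18 × w_22) by `B5_add`, S4 is a triple product (`S4_eq`,
`S4_eq'`), and B7 is a triple product of two cross products and a vector (`B7_eq`). At level one,
nodes 2 and 4 are products of two triple products, evaluated as Gram determinants. Node 3 follows
from node 4 and an instance of Cramer's rule (`S6_mul_B7`), node 1 from `B5_add` alone. At level
two, node 1 is the definition of S6, node 2 is Euler's continuant identity, and nodes 3 and 4 are
factorizations.

To return to meromorphic functions, φ and Q must be non-zero and duality must hold along the whole
lattice through x. By periodicity these are conditions at 48 points, so they hold off a discrete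
closed set (`eventually_isFusion`). -/

noncomputable section

namespace DiluteA5

/-! ### Vectors solving the fusion recursion -/

section Vectors

open Matrix

variable {K : Type*} [Field K]

/-- A third order linear recursion for vectors, whose coefficients are those of the
difference equation solved by the functions `T_m`. -/
def fusionVec (p τ : ℕ → K) : ℕ → Fin 3 → K
  -- Vectors 0, 2, 4 form a scaled basis; 1 and 3 are then forced by the cross products, and 5 by
  -- its scalar products with 0, 2 and 4.
  | 0 => ![p 1 * p 2 * p 3, 0, 0]
  | 1 => ![0, 0, p 2 * p 3]
  | 2 => ![0, 1, 0]
  | 3 => ![1 / p 3, 0, 0]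
  | 4 => ![0, 0, 1]
  | 5 => ![τ 0 / (p 1 * p 2 * p 3), p 3 * p 4, 0]
  | n + 6 =>
    (τ (n + 1) / (p (n + 2) * p (n + 3))) • fusionVec p τ (n + 4) -
      (τ n * p (n + 5) / (p (n + 1) * p (n + 2) * p (n + 3))) • fusionVec p τ (n + 2) +
      (p (n + 4) * p (n + 5) / (p (n + 1) * p (n + 2))) • fusionVec p τ n

variable {p τ : ℕ → K}

theorem fusionVec_rec (n : ℕ) : fusionVec p τ (n + 6) =
    (τ (n + 1) / (p (n + 2) * p (n + 3))) • fusionVec p τ (n + 4) -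
      (τ n * p (n + 5) / (p (n + 1) * p (n + 2) * p (n + 3))) • fusionVec p τ (n + 2) +
      (p (n + 4) * p (n + 5) / (p (n + 1) * p (n + 2))) • fusionVec p τ n := by
  rw [fusionVec]

/-- Cross products of consecutive vectors of one parity solve the adjoint recursion. With these
coefficients it is the original recursion rescaled by p, so they continue to match the vectors of
the other parity. -/
theorem fusionVec_cross (hp : ∀ n, p n ≠ 0) (n : ℕ) :
    fusionVec p τ n ⨯₃ fusionVec p τ (n + 2) = p (n + 1) • fusionVec p τ (n + 1) := by
  induction n using Nat.strong_induction_on with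
  | _ n ih =>
    have h1 := hp 1
    have h2 := hp 2
    have h3 := hp 3
    have h4 := hp 4
    match n, ih with
    | 0, _ => ext i; fin_cases i <;> simp [fusionVec, cross_apply]; ring
    | 1, _ => ext i; fin_cases i <;> simp [fusionVec, cross_apply]; field_simp
    | 2, _ => ext i; fin_cases i <;> simp [fusionVec, cross_apply]; field_simp
    | 3, _ => ext i; fin_cases i <;> simp [fusionVec, cross_apply]; field_simp
    | 4, _ =>
      ext i; fin_cases i <;> simp [fusionVec, cross_apply] <;> field_simp
    | 5, _ =>
      ext i; fin_cases i <;> simp [fusionVec, cross_apply] <;> field_simp <;> ring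
    | n + 6, ih =>
      have e0 := ih n (by omega)
      have e2 := ih (n + 2) (by omega)
      have e4 := ih (n + 4) (by omega)
      have r8 : fusionVec p τ (n + 8) = _ := fusionVec_rec (n + 2)
      have r7 : fusionVec p τ (n + 7) = _ := fusionVec_rec (n + 1)
      have r6 := fusionVec_rec (p := p) (τ := τ) n
      have q1 := hp (n + 1)
      have q2 := hp (n + 2)
      have q3 := hp (n + 3)
      have q4 := hp (n + 4)
      have q5 := hp (n + 5)
      have q6 := hp (n + 6)
      have q7 := hp (n + 7)
      -- The recursion for vector n + 8 reduces its cross product with vector n + 6 to this one and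
      -- to a known consecutive one.
      have e26 : fusionVec p τ (n + 2) ⨯₃ fusionVec p τ (n + 6) =
          (τ (n + 1) / (p (n + 2) * p (n + 3))) • p (n + 3) • fusionVec p τ (n + 3) -
          (p (n + 4) * p (n + 5) / (p (n + 1) * p (n + 2))) • p (n + 1) •
            fusionVec p τ (n + 1) := by
        rw [r6, ← e0, ← e2, map_add, map_sub, map_smul, map_smul, map_smul, cross_self,
          ← cross_anticomm (fusionVec p τ n)]
        module
      have e68 : fusionVec p τ (n + 6) ⨯₃ fusionVec p τ (n + 8) =
          (τ (n + 2) * p (n + 7) / (p (n + 3) * p (n + 4) * p (n + 5))) • p (n + 5) •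
            fusionVec p τ (n + 5) -
          (p (n + 6) * p (n + 7) / (p (n + 3) * p (n + 4))) •
            (fusionVec p τ (n + 2) ⨯₃ fusionVec p τ (n + 6)) := by
        rw [r8, ← e4, map_add, map_sub, map_smul, map_smul, map_smul, cross_self,
          ← cross_anticomm (fusionVec p τ (n + 4)), ← cross_anticomm (fusionVec p τ (n + 2))]
        module
      show fusionVec p τ (n + 6) ⨯₃ fusionVec p τ (n + 8) = p (n + 7) • fusionVec p τ (n + 7)
      rw [e68, e26, r7]
      ext i
      simp only [Pi.smul_apply, Pi.sub_apply, Pi.add_apply, smul_eq_mul]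
      show _ = p (n + 7) * (τ (n + 2) / (p (n + 3) * p (n + 4)) * fusionVec p τ (n + 5) i -
        τ (n + 1) * p (n + 6) / (p (n + 2) * p (n + 3) * p (n + 4)) * fusionVec p τ (n + 3) i +
        p (n + 5) * p (n + 6) / (p (n + 2) * p (n + 3)) * fusionVec p τ (n + 1) i)
      field_simp
      ring

theorem fusionVec_dot_one (hp : ∀ n, p n ≠ 0) (n : ℕ) :
    fusionVec p τ n ⬝ᵥ fusionVec p τ (n + 1) = 0 := by
  have h := congrArg (fun v => fusionVec p τ n ⬝ᵥ v) (fusionVec_cross (τ := τ) hp n)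
  simpa [dot_self_cross, hp] using h.symm

theorem fusionVec_dot_one' (hp : ∀ n, p n ≠ 0) (n : ℕ) :
    fusionVec p τ (n + 1) ⬝ᵥ fusionVec p τ n = 0 := by
  rw [dotProduct_comm, fusionVec_dot_one hp]

theorem fusionVec_dot_three (hp : ∀ n, p n ≠ 0) (n : ℕ) :
    fusionVec p τ n ⬝ᵥ fusionVec p τ (n + 3) = p (n + 1) * p (n + 2) := by
  induction n using Nat.strong_induction_on with
  | _ n ih =>
    have h3 := hp 3
    match n, ih with
    | 0, _ => simp [fusionVec, h3]
    | 1, _ => simp [fusionVec]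
    | 2, _ => simp [fusionVec]
    | n + 3, ih =>
      have e := ih n (by omega)
      have r6 := fusionVec_rec (p := p) (τ := τ) n
      have q1 := hp (n + 1)
      have q2 := hp (n + 2)
      show fusionVec p τ (n + 3) ⬝ᵥ fusionVec p τ (n + 6) = _
      rw [r6, dotProduct_add, dotProduct_sub, dotProduct_smul, dotProduct_smul, dotProduct_smul,
        fusionVec_dot_one hp (n + 3), fusionVec_dot_one' hp (n + 2),
        dotProduct_comm (fusionVec p τ (n + 3)), e]
      simp only [smul_eq_mul]
      field_simp
      ring

theorem fusionVec_dot_five (hp : ∀ n, p n ≠ 0) (n : ℕ) :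
    fusionVec p τ n ⬝ᵥ fusionVec p τ (n + 5) = τ n := by
  have h1 := hp 1
  have h2 := hp 2
  have h3 := hp 3
  match n with
  | 0 => simp [fusionVec]; field_simp
  | n + 1 =>
    have r6 := fusionVec_rec (p := p) (τ := τ) n
    have q1 := hp (n + 2)
    have q2 := hp (n + 3)
    show fusionVec p τ (n + 1) ⬝ᵥ fusionVec p τ (n + 6) = _
    rw [r6, dotProduct_add, dotProduct_sub, dotProduct_smul, dotProduct_smul, dotProduct_smul,
      fusionVec_dot_one hp (n + 1), fusionVec_dot_one' hp n, fusionVec_dot_three hp (n + 1)]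
    simp only [smul_eq_mul]
    field_simp
    ring

end Vectors

/-! ### Fusion relations on the lattice, realized by vectors -/

section Abstract

open Matrix

variable {K : Type*} [Field K]

/-- The relations between the values `T m k` of the fusion transfer matrices and `p k` of the
vacuum function on a lattice of step `i/14`, on which the period is `48`. -/
structure IsFusion (T : ℤ → ℤ → K) (p : ℤ → K) : Prop where
  p_ne : ∀ k, p k ≠ 0
  p_add : ∀ k, p (k + 48) = p k
  T_neg : ∀ m k, m < 0 → T m k = 0
  T_zero : ∀ k, T 0 k = p (k + 7) * p (k - 7)
  T_rec : ∀ m k, 1 ≤ m → T m k =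
    T 1 (k + 14 * m - 14) / (p (k + 14 * m - 35) * p (k + 14 * m - 21)) * T (m - 1) (k - 14) -
    T 1 (k + 14 * m - 28) * p (k + 14 * m + 7) /
      (p (k + 14 * m - 49) * p (k + 14 * m - 35) * p (k + 14 * m - 21)) * T (m - 2) (k - 28) +
    p (k + 14 * m - 7) * p (k + 14 * m + 7) / (p (k + 14 * m - 49) * p (k + 14 * m - 35)) *
      T (m - 3) (k - 42)
  dual : ∀ m k, 0 ≤ m → m ≤ 10 → T m k = T (9 - m) (k + 24)

namespace IsFusion

variable {T : ℤ → ℤ → K} {p : ℤ → K}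

theorem p_mod (H : IsFusion T p) {k l : ℤ} (h : (48 : ℤ) ∣ k - l) : p k = p l := by
  have hn : ∀ (k : ℤ) (n : ℕ), p (k + 48 * n) = p k := by
    intro k n
    induction n with
    | zero => simp
    | succ n ih => rw [← ih, ← H.p_add (k + 48 * n)]; congr 1; push_cast; ring
  obtain ⟨q, hq⟩ := h
  obtain ⟨n, rfl | rfl⟩ := Int.eq_nat_or_neg q
  · rw [← hn l n]; congr 1; linarith
  · rw [← hn k n]; congr 1; linarith

theorem T_add (H : IsFusion T p) {m : ℤ} (h0 : 0 ≤ m) (h9 : m ≤ 9) (k : ℤ) :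
    T m (k + 48) = T m k := by
  rw [H.dual m k h0 (by omega), H.dual (9 - m) (k + 24) (by omega) (by omega)]
  congr 1 <;> ring

theorem T_mod (H : IsFusion T p) {m k l : ℤ} (h0 : 0 ≤ m) (h9 : m ≤ 9)
    (h : (48 : ℤ) ∣ k - l) : T m k = T m l := by
  have hn : ∀ (k : ℤ) (n : ℕ), T m (k + 48 * n) = T m k := by
    intro k n
    induction n with
    | zero => simp
    | succ n ih => rw [← ih, ← H.T_add h0 h9 (k + 48 * n)]; congr 1; push_cast; ring
  obtain ⟨q, hq⟩ := h
  obtain ⟨n, rfl | rfl⟩ := Int.eq_nat_or_neg q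
  · rw [← hn l n]; congr 1; linarith
  · rw [← hn k n]; congr 1; linarith

theorem T_dual (H : IsFusion T p) {m n k l : ℤ} (h0 : 0 ≤ m) (h9 : m ≤ 9) (hm : m + n = 9)
    (h : (48 : ℤ) ∣ k + 24 - l) : T m k = T n l := by
  rw [H.dual m k h0 (by omega), ← H.T_mod (m := n) (by omega) (by omega) h]
  congr 1; omega

/-- At index 10 duality reaches a negative index. This zero is the vanishing corner of the Gram
matrix in `B5_add`. -/
theorem T_ten (H : IsFusion T p) (k : ℤ) : T 10 k = 0 := by
  rw [H.dual 10 k (by norm_num) (by norm_num), H.T_neg _ _ (by norm_num)]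

theorem T_zero' (H : IsFusion T p) {k a b : ℤ} (ha : (48 : ℤ) ∣ k + 7 - a)
    (hb : (48 : ℤ) ∣ k - 7 - b) : T 0 k = p a * p b := by
  rw [H.T_zero, H.p_mod ha, H.p_mod hb]

/-- A sequence of vectors, `w n` standing at position `s + 14 n` of the lattice, whose scalar
products are the values of the fusion transfer matrices. -/
structure IsVec (T : ℤ → ℤ → K) (p : ℤ → K) (s : ℤ) (w : ℕ → Fin 3 → K) : Prop where
  cross' : ∀ n : ℕ, w n ⨯₃ w (n + 2) = p (s + 14 * (n + 1 : ℕ)) • w (n + 1)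
  dot_one : ∀ n, w n ⬝ᵥ w (n + 1) = 0
  dot' : ∀ n m : ℕ, w n ⬝ᵥ w (n + 2 * m + 3) = T m (s + 14 * n + 14 * m + 21)

theorem exists_isVec (H : IsFusion T p) (s : ℤ) : ∃ w, IsVec T p s w := by
  have hp : ∀ n : ℕ, (fun n : ℕ => p (s + 14 * n)) n ≠ 0 := fun n => H.p_ne _
  -- The offset 35 is half of five steps of 14: T_1 stands at the midpoint of vectors n and n + 5.
  refine ⟨fusionVec (fun n : ℕ => p (s + 14 * n)) (fun n : ℕ => T 1 (s + 14 * n + 35)),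
    fusionVec_cross hp, fusionVec_dot_one hp, fun n m => ?_⟩
  induction m using Nat.strong_induction_on with
  | _ m ih =>
    match m, ih with
    | 0, _ =>
      rw [show n + 2 * 0 + 3 = n + 3 by ring, fusionVec_dot_three hp, Nat.cast_zero, H.T_zero,
        mul_comm]
      congr 2 <;> push_cast <;> ring
    | 1, _ =>
      rw [show n + 2 * 1 + 3 = n + 5 by ring, fusionVec_dot_five hp]
      congr 1
      push_cast; ring
    | 2, ih =>
      have e1 := ih 1 (by norm_num)
      have e0 := ih 0 (by norm_num)
      rw [show n + 2 * 1 + 3 = n + 5 by ring] at e1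
      rw [show n + 2 * 0 + 3 = n + 3 by ring] at e0
      -- The vanishing of T_{-1} corresponds to the orthogonality of neighbouring vectors.
      rw [show n + 2 * 2 + 3 = (n + 1) + 6 by ring, fusionVec_rec, dotProduct_add,
        dotProduct_sub, dotProduct_smul, dotProduct_smul, dotProduct_smul,
        show n + 1 + 4 = n + 5 by ring, show n + 1 + 2 = n + 3 by ring, e1, e0,
        fusionVec_dot_one hp, H.T_rec ((2 : ℕ) : ℤ) _ (by norm_num),
        H.T_neg (((2 : ℕ) : ℤ) - 3) _ (by norm_num)]
      simp only [smul_eq_mul, mul_zero]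
      congr 1
      congr 1 <;> push_cast <;> ring_nf
    | m + 3, ih =>
      have e2 := ih (m + 2) (by omega)
      have e1 := ih (m + 1) (by omega)
      have e0 := ih m (by omega)
      rw [show n + 2 * (m + 2) + 3 = n + 2 * m + 3 + 4 by ring] at e2
      rw [show n + 2 * (m + 1) + 3 = n + 2 * m + 3 + 2 by ring] at e1
      rw [show n + 2 * (m + 3) + 3 = (n + 2 * m + 3) + 6 by ring, fusionVec_rec, dotProduct_add,
        dotProduct_sub, dotProduct_smul, dotProduct_smul, dotProduct_smul, e2, e1, e0,
        H.T_rec ((m + 3 : ℕ) : ℤ) _ (by push_cast; omega)]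
      simp only [smul_eq_mul]
      congr 1
      · congr 1 <;> push_cast <;> ring_nf
      · push_cast; ring_nf

namespace IsVec

variable {s : ℤ} {w : ℕ → Fin 3 → K}

theorem dot (V : IsVec T p s w) (H : IsFusion T p) (a b : ℕ) (m : ℤ) {k : ℤ}
    (hab : (b : ℤ) = a + 2 * m + 3 := by norm_num)
    (h0 : 0 ≤ m := by norm_num) (h9 : m ≤ 9 := by norm_num)
    (h : (48 : ℤ) ∣ s + 14 * a + 14 * m + 21 - k := by (push_cast; omega)) :
    w a ⬝ᵥ w b = T m k := by
  lift m to ℕ using h0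
  obtain rfl : b = a + 2 * m + 3 := by omega
  rw [V.dot', H.T_mod (by positivity) h9 h]

/-- The midpoint value is T_{9-m}; duality turns it into T_m half a period away. As in `dot`,
positions matter only modulo 48, and the default arguments check the index arithmetic. -/
theorem dot_dual (V : IsVec T p s w) (H : IsFusion T p) (a b : ℕ) (m : ℤ) {k : ℤ}
    (hab : (b : ℤ) = a + 2 * (9 - m) + 3 := by norm_num)
    (h0 : 0 ≤ m := by norm_num) (h9 : m ≤ 9 := by norm_num)
    (h : (48 : ℤ) ∣ s + 14 * a + 14 * (9 - m) + 21 + 24 - k := by (push_cast; omega)) :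
    w a ⬝ᵥ w b = T m k := by
  rw [V.dot H a b (9 - m) (k := s + 14 * a + 14 * (9 - m) + 21) hab (by omega) (by omega)
    (by simp)]
  exact H.T_dual (by omega) (by omega) (by omega) h

theorem dot_ten (V : IsVec T p s w) (H : IsFusion T p) (a : ℕ) : w a ⬝ᵥ w (a + 23) = 0 := by
  exact (V.dot' a 10).trans (H.T_ten _)

theorem cross (V : IsVec T p s w) (H : IsFusion T p) (a : ℕ) {k : ℤ}
    (h : (48 : ℤ) ∣ s + 14 * (a + 1 : ℕ) - k := by (push_cast; omega)) :
    w a ⨯₃ w (a + 2) = p k • w (a + 1) := by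
  rw [V.cross', H.p_mod h]

end IsVec

end IsFusion

/-- The determinant of three vectors. -/
def tri (a b c : Fin 3 → K) : K := a ⬝ᵥ b ⨯₃ c

/-- Multiplicativity of the determinant, with the Gram matrix of scalar products expanded. -/
theorem tri_mul_tri (a b c d e f : Fin 3 → K) : tri a b c * tri d e f =
    (a ⬝ᵥ d) * ((b ⬝ᵥ e) * (c ⬝ᵥ f) - (b ⬝ᵥ f) * (c ⬝ᵥ e)) -
    (a ⬝ᵥ e) * ((b ⬝ᵥ d) * (c ⬝ᵥ f) - (b ⬝ᵥ f) * (c ⬝ᵥ d)) +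
    (a ⬝ᵥ f) * ((b ⬝ᵥ d) * (c ⬝ᵥ e) - (b ⬝ᵥ e) * (c ⬝ᵥ d)) := by
  simp only [tri, cross_apply, vec3_dotProduct, cons_val_zero, cons_val_one, cons_val]
  ring

theorem tri_rotate (a b c : Fin 3 → K) : tri a b c = tri b c a := triple_product_permutation ..

theorem tri_swap (a b c : Fin 3 → K) : tri a b c = -tri a c b := by
  rw [tri, tri, ← cross_anticomm, dotProduct_neg]

end Abstract

/-! ### Vector forms of the solution; nodes 1 and 4 at level one -/

section Identities

open Matrix

variable {K : Type*} [Field K]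

namespace IsFusion

variable (T : ℤ → ℤ → K) (p : ℤ → K)

/-- Here and in the next five definitions, duality and periodicity have already simplified the skew
determinants. B3, B5 and B7 become normalized continuants in T_1 and T_0. -/
def B3 (k : ℤ) : K := (T 1 (k + 3) * T 1 (k - 3) - T 0 (k + 11) * T 0 (k - 11)) / p (k + 24)

def B5 (k : ℤ) : K :=
  (T 1 (k + 6) * T 1 k * T 1 (k - 6) - T 1 (k + 6) * (T 0 (k + 8) * T 0 (k - 14)) -
    T 1 (k - 6) * (T 0 (k - 8) * T 0 (k + 14))) / (p (k + 21) * p (k - 21))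

def B7 (k : ℤ) : K :=
  (T 1 (k + 9) * T 1 (k + 3) * T 1 (k - 3) * T 1 (k - 9) -
    T 0 (k + 17) * T 0 (k - 5) * (T 1 (k - 3) * T 1 (k - 9)) -
    T 0 (k + 11) * T 0 (k - 11) * (T 1 (k + 9) * T 1 (k - 9)) -
    T 0 (k + 5) * T 0 (k - 17) * (T 1 (k + 9) * T 1 (k + 3)) +
    T 0 (k + 17) * T 0 (k - 5) * (T 0 (k + 5) * T 0 (k - 17))) /
    (p (k + 24) * p (k + 18) * p (k - 18))

def S6 (k : ℤ) : K := T 7 (k + 3) * T 7 (k - 3) - T 0 (k + 1) * T 0 (k - 1)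

def S3 (k : ℤ) : K :=
  T 7 (k + 2) * (T 4 k * T 7 (k - 2) - T 0 (k + 2) * T 7 (k - 4)) -
    T 0 (k - 2) * (T 7 (k + 4) * T 7 (k - 2) - T 0 (k + 2) * T 0 k)

def S4 (k : ℤ) : K := (T 4 (k + 5) * T 1 (k - 7) - T 3 (k - 9) * T 0 (k + 7)) / p (k + 20)

variable {T p}

/-- Both triple products contain vectors two apart, so each collapses to p times a T_7, while their
Gram determinant contains the continuant of B5. Through Binet–Cauchy the result makes B5 a scalar
product of two cross products. -/
theorem B5_add (H : IsFusion T p) (k : ℤ) :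
    B5 T p k + T 0 k * T 4 k = T 7 (k + 4) * T 7 (k - 4) := by
  obtain ⟨w, V⟩ := H.exists_isVec (k + 7)
  have a1 : w 18 ⬝ᵥ w 23 = T 1 (k + 6) := V.dot H _ _ 1
  have a2 : w 2 ⬝ᵥ w 21 = T 1 k := V.dot_dual H _ _ 1
  have a3 : w 0 ⬝ᵥ w 5 = T 1 (k - 6) := V.dot H _ _ 1
  have b1 : w 2 ⬝ᵥ w 5 = T 0 (k + 8) := V.dot H _ _ 0
  have b2 : w 0 ⬝ᵥ w 21 = T 0 (k - 14) := V.dot_dual H _ _ 0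
  have b3 : w 18 ⬝ᵥ w 21 = T 0 (k - 8) := V.dot H _ _ 0
  have b4 : w 2 ⬝ᵥ w 23 = T 0 (k + 14) := V.dot_dual H _ _ 0
  have c1 : w 0 ⬝ᵥ w 23 = 0 := V.dot_ten H 0
  have c2 : w 5 ⬝ᵥ w 18 = T 4 k := V.dot_dual H _ _ 4
  have c3 : w 1 ⬝ᵥ w 18 = T 7 (k - 4) := V.dot H _ _ 7
  have c4 : w 5 ⬝ᵥ w 22 = T 7 (k + 4) := V.dot H _ _ 7
  have x1 : w 0 ⨯₃ w 2 = p (k + 21) • w 1 := V.cross H 0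
  have x2 : w 21 ⨯₃ w 23 = p (k - 21) • w 22 := V.cross H 21
  have g := tri_mul_tri (w 18) (w 0) (w 2) (w 5) (w 21) (w 23)
  rw [tri, tri, x1, x2, dotProduct_smul, dotProduct_smul, dotProduct_comm (w 18) (w 1), c3, c4,
    dotProduct_comm (w 18) (w 5), c2, a1, a2, a3, b2, b3, b4, c1, b1] at g
  have z : T 0 (k + 14) * T 0 (k - 14) = p (k + 21) * p (k - 21) * T 0 k := by
    rw [H.T_zero, H.T_zero, H.T_zero]
    ring_nf
  have h1 := H.p_ne (k + 21)
  have h2 := H.p_ne (k - 21)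
  rw [B5]
  field_simp
  simp only [smul_eq_mul] at g
  linear_combination -g - T 4 k * z

/-- The numerator is a Binet–Cauchy minor in which one cross product collapses to p times a vector.
`S4_eq'` finds the same value elsewhere in the sequence, so that neighbouring arguments can share
one sequence. -/
theorem S4_eq (H : IsFusion T p) {s k : ℤ} {w : ℕ → Fin 3 → K} (V : IsVec T p s w) (j : ℕ)
    (h : (48 : ℤ) ∣ s + 14 * j - (k + 6)) :
    S4 T p k = tri (w (j + 1)) (w (j + 5)) (w (j + 15)) := by
  have a1 : w (j + 2) ⬝ᵥ w (j + 15) = T 4 (k + 5) := V.dot_dual H _ _ 4 (by push_cast; ring)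
  have a2 : w j ⬝ᵥ w (j + 5) = T 1 (k - 7) := V.dot H _ _ 1 (by push_cast; ring)
  have a3 : w j ⬝ᵥ w (j + 15) = T 3 (k - 9) := V.dot_dual H _ _ 3 (by push_cast; ring)
  have a4 : w (j + 2) ⬝ᵥ w (j + 5) = T 0 (k + 7) := V.dot H _ _ 0 (by push_cast; ring)
  have x : w j ⨯₃ w (j + 2) = p (k + 20) • w (j + 1) := V.cross H j
  have g := cross_dot_cross (w j) (w (j + 2)) (w (j + 5)) (w (j + 15))
  rw [x, smul_dotProduct, a1, a2, a3, a4, smul_eq_mul] at g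
  have h1 := H.p_ne (k + 20)
  rw [S4, tri]
  field_simp
  linear_combination -g

theorem S4_eq' (H : IsFusion T p) {s k : ℤ} {w : ℕ → Fin 3 → K} (V : IsVec T p s w) (j : ℕ)
    (h : (48 : ℤ) ∣ s + 14 * j - (k + 24)) :
    S4 T p k = tri (w (j + 10)) (w (j + 14)) (w j) := by
  have a1 : w j ⬝ᵥ w (j + 11) = T 4 (k + 5) := V.dot H _ _ 4 (by push_cast; ring)
  have a2 : w (j + 9) ⬝ᵥ w (j + 14) = T 1 (k - 7) := V.dot H _ _ 1 (by push_cast; ring)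
  have a3 : w j ⬝ᵥ w (j + 9) = T 3 (k - 9) := V.dot H _ _ 3 (by push_cast; ring)
  have a4 : w (j + 11) ⬝ᵥ w (j + 14) = T 0 (k + 7) := V.dot H _ _ 0 (by push_cast; ring)
  have x : w (j + 9) ⨯₃ w (j + 11) = p (k + 20) • w (j + 10) := V.cross H (j + 9)
  have g := cross_dot_cross (w (j + 9)) (w (j + 11)) (w (j + 14)) (w j)
  rw [x, smul_dotProduct, a2, a4, dotProduct_comm, dotProduct_comm (w (j + 11)), a1,
    dotProduct_comm (w (j + 9)), a3, smul_eq_mul, dotProduct_comm] at g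
  have h1 := H.p_ne (k + 20)
  rw [S4, tri]
  field_simp
  linear_combination -g

theorem B7_eq (H : IsFusion T p) {s k : ℤ} {w : ℕ → Fin 3 → K} (V : IsVec T p s w) (j : ℕ)
    (h : (48 : ℤ) ∣ s + 14 * j - (k + 22)) :
    B7 T p k = tri (w j ⨯₃ w (j + 4)) (w (j + 14) ⨯₃ w (j + 10)) (w (j + 7)) := by
  have a1 : w j ⬝ᵥ w (j + 5) = T 1 (k + 9) := V.dot H _ _ 1 (by push_cast; ring)
  have a2 : w (j + 3) ⬝ᵥ w (j + 8) = T 1 (k + 3) := V.dot H _ _ 1 (by push_cast; ring)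
  have a3 : w (j + 6) ⬝ᵥ w (j + 11) = T 1 (k - 3) := V.dot H _ _ 1 (by push_cast; ring)
  have a4 : w (j + 9) ⬝ᵥ w (j + 14) = T 1 (k - 9) := V.dot H _ _ 1 (by push_cast; ring)
  have l1 : w (j + 5) ⬝ᵥ w (j + 8) = T 0 (k + 17) := V.dot H _ _ 0 (by push_cast; ring)
  have l2 : w j ⬝ᵥ w (j + 3) = T 0 (k - 5) := V.dot H _ _ 0 (by push_cast; ring)
  have l3 : w (j + 8) ⬝ᵥ w (j + 11) = T 0 (k + 11) := V.dot H _ _ 0 (by push_cast; ring)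
  have l4 : w (j + 3) ⬝ᵥ w (j + 6) = T 0 (k - 11) := V.dot H _ _ 0 (by push_cast; ring)
  have l5 : w (j + 11) ⬝ᵥ w (j + 14) = T 0 (k + 5) := V.dot H _ _ 0 (by push_cast; ring)
  have l6 : w (j + 6) ⬝ᵥ w (j + 9) = T 0 (k - 17) := V.dot H _ _ 0 (by push_cast; ring)
  have x3 : w (j + 3) ⨯₃ w (j + 5) = p (k - 18) • w (j + 4) := V.cross H (j + 3)
  have x4 : w (j + 4) ⨯₃ w (j + 6) = p (k - 4) • w (j + 5) := V.cross H (j + 4)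
  have x6 : w (j + 6) ⨯₃ w (j + 8) = p (k + 24) • w (j + 7) := V.cross H (j + 6)
  have x8 : w (j + 8) ⨯₃ w (j + 10) = p (k + 4) • w (j + 9) := V.cross H (j + 8)
  have x9 : w (j + 9) ⨯₃ w (j + 11) = p (k + 18) • w (j + 10) := V.cross H (j + 9)
  have g1 := cross_dot_cross (w (j + 3)) (w (j + 5)) (w j) (w (j + 8))
  rw [x3, smul_dotProduct, a2, l1, dotProduct_comm _ (w j), dotProduct_comm _ (w j), l2, a1] at g1
  have g2 := cross_dot_cross (w (j + 9)) (w (j + 11)) (w (j + 6)) (w (j + 14))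
  rw [x9, smul_dotProduct, a4, l5, dotProduct_comm _ (w (j + 6)), dotProduct_comm _ (w (j + 6)),
    l6, a3] at g2
  have g3 := congrArg (fun v => w j ⬝ᵥ v) x4
  have g4 := congrArg (fun v => v ⬝ᵥ w (j + 14)) x8
  simp only [dotProduct_smul, smul_dotProduct, a1, a4, smul_eq_mul] at g1 g2 g3 g4
  have z1 : T 0 (k - 11) = p (k - 18) * p (k - 4) := by
    rw [H.T_zero]; ring_nf
  have z2 : T 0 (k + 11) = p (k + 18) * p (k + 4) := by
    rw [H.T_zero]; ring_nf
  -- This is a · (b × (c × d)) = (a · c)(b · d) - (a · d)(b · c). Each factor on the right is then a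
  -- triple product computed from `g1` to `g4`.
  have key : tri (w j ⨯₃ w (j + 4)) (w (j + 14) ⨯₃ w (j + 10)) (w (j + 6) ⨯₃ w (j + 8)) =
      (w (j + 4) ⬝ᵥ w j ⨯₃ w (j + 8)) * (w (j + 10) ⬝ᵥ w (j + 6) ⨯₃ w (j + 14)) -
      (w j ⬝ᵥ w (j + 4) ⨯₃ w (j + 6)) * (w (j + 8) ⨯₃ w (j + 10) ⬝ᵥ w (j + 14)) := by
    simp only [tri, cross_apply, vec3_dotProduct, cons_val_zero, cons_val_one, cons_val]
    ring
  have e6 : tri (w j ⨯₃ w (j + 4)) (w (j + 14) ⨯₃ w (j + 10)) (w (j + 6) ⨯₃ w (j + 8)) =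
      p (k + 24) * tri (w j ⨯₃ w (j + 4)) (w (j + 14) ⨯₃ w (j + 10)) (w (j + 7)) := by
    rw [x6, tri, tri, map_smul, dotProduct_smul, smul_eq_mul]
  have h1 := H.p_ne (k + 24)
  have h2 := H.p_ne (k + 18)
  have h3 := H.p_ne (k - 18)
  rw [e6] at key
  rw [B7, z1, z2]
  field_simp
  linear_combination (-p (k + 18) * p (k - 18)) * key -
    p (k - 18) * (w (j + 4) ⬝ᵥ w j ⨯₃ w (j + 8)) * g2 -
    (T 0 (k - 17) * T 0 (k + 5) - T 1 (k - 9) * T 1 (k - 3)) * g1 +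
    p (k + 18) * p (k - 18) * (w (j + 8) ⨯₃ w (j + 10) ⬝ᵥ w (j + 14)) * g3 +
    p (k + 18) * p (k - 18) * p (k - 4) * T 1 (k + 9) * g4

/-- The relation of the `D₄` related `T`-system at node `1` and level one. -/
theorem S6_mul_S6 (H : IsFusion T p) (k : ℤ) : S6 T (k + 1) * S6 T (k - 1) =
    B5 T p k * (T 7 (k + 2) * T 7 (k - 2)) + T 0 k * S3 T k := by
  have h := H.B5_add k
  rw [S6, S6, S3, show k + 1 + 3 = k + 4 by ring, show k + 1 - 3 = k - 2 by ring,
    show k - 1 + 3 = k + 2 by ring, show k - 1 - 3 = k - 4 by ring,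
    show k + 1 + 1 = k + 2 by ring, show k - 1 - 1 = k - 2 by ring,
    show k + 1 - 1 = k by ring, show k - 1 + 1 = k by ring]
  linear_combination (-T 7 (k + 2) * T 7 (k - 2)) * h

/-- The relation of the `D₄` related `T`-system at node `4` and level one. -/
theorem S4_mul_S4 (H : IsFusion T p) (k : ℤ) : S4 T p (k + 1) * S4 T p (k - 1) =
    B5 T p k * T 7 k + S3 T k := by
  obtain ⟨w, V⟩ := H.exists_isVec (k + 7)
  have e1 : S4 T p (k + 1) = tri (w 1) (w 5) (w 15) := H.S4_eq V 0 (by push_cast; omega)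
  have e2 : S4 T p (k - 1) = tri (w 18) (w 22) (w 8) := H.S4_eq' V 8 (by push_cast; omega)
  have h := H.B5_add k
  have a1 : w 1 ⬝ᵥ w 18 = T 7 (k - 4) := V.dot H _ _ 7
  have a2 : w 1 ⬝ᵥ w 22 = T 0 k := V.dot_dual H _ _ 0
  have a3 : w 1 ⬝ᵥ w 8 = T 7 (k - 2) := V.dot_dual H _ _ 7
  have a4 : w 5 ⬝ᵥ w 18 = T 4 k := V.dot_dual H _ _ 4
  have a5 : w 5 ⬝ᵥ w 22 = T 7 (k + 4) := V.dot H _ _ 7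
  have a6 : w 5 ⬝ᵥ w 8 = T 0 (k + 2) := V.dot H _ _ 0
  have a7 : w 15 ⬝ᵥ w 18 = T 0 (k - 2) := V.dot H _ _ 0
  have a8 : w 15 ⬝ᵥ w 22 = T 7 (k + 2) := V.dot_dual H _ _ 7
  have a9 : w 15 ⬝ᵥ w 8 = T 7 k := by
    rw [dotProduct_comm]; exact V.dot_dual H _ _ 7
  -- In the Gram determinant the cofactor of T 7 k is B5 by `B5_add`; the remaining terms are S3.
  rw [e1, e2, tri_mul_tri, a1, a2, a3, a4, a5, a6, a7, a8, a9, S3]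
  linear_combination (-T 7 k) * h

end IsFusion

end Identities

/-! ### Nodes 2 and 3 at level one, and the relations at level two -/

section Identities

open Matrix

variable {K : Type*} [Field K]

namespace IsFusion

variable {T : ℤ → ℤ → K} {p : ℤ → K}

/-- The relation of the `D₄` related `T`-system at node `2` and level one. -/
theorem B7_mul_B7 (H : IsFusion T p) (k : ℤ) : B7 T p (k + 1) * B7 T p (k - 1) =
    B5 T p (k + 2) * B5 T p (k - 2) * T 7 k + T 0 (k + 4) * T 0 (k - 4) * S3 T k := by
  obtain ⟨w, V⟩ := H.exists_isVec (k + 7)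
  have e1 : B7 T p (k + 1) = tri (w 8 ⨯₃ w 12) (w 22 ⨯₃ w 18) (w 15) :=
    H.B7_eq V 8 (by push_cast; omega)
  have e2 : B7 T p (k - 1) = tri (w 1 ⨯₃ w 5) (w 15 ⨯₃ w 11) (w 8) :=
    H.B7_eq V 1 (by push_cast; omega)
  have f1 : S4 T p (k + 1) = tri (w 1) (w 5) (w 15) := H.S4_eq V 0 (by push_cast; omega)
  have f2 : S4 T p (k - 1) = tri (w 18) (w 22) (w 8) := H.S4_eq' V 8 (by push_cast; omega)
  have ac : w 8 ⨯₃ w 12 ⬝ᵥ w 1 ⨯₃ w 5 = B5 T p (k + 2) := by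
    have h := H.B5_add (k + 2)
    have a1 : w 8 ⬝ᵥ w 1 = T 7 (k + 2 - 4) := by
      rw [dotProduct_comm]; exact V.dot_dual H _ _ 7
    have a2 : w 12 ⬝ᵥ w 5 = T 7 (k + 2 + 4) := by
      rw [dotProduct_comm]; exact V.dot_dual H _ _ 7
    have a3 : w 8 ⬝ᵥ w 5 = T 0 (k + 2) := by
      rw [dotProduct_comm]; exact V.dot H _ _ 0
    have a4 : w 12 ⬝ᵥ w 1 = T 4 (k + 2) := by
      rw [dotProduct_comm]; exact V.dot H _ _ 4
    rw [cross_dot_cross, a1, a2, a3, a4]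
    linear_combination -h
  have ad : w 8 ⨯₃ w 12 ⬝ᵥ w 15 ⨯₃ w 11 = -(T 0 (k - 4) * T 0 (k + 4)) := by
    have a1 : w 8 ⬝ᵥ w 11 = T 0 (k - 4) := V.dot H _ _ 0
    have a2 : w 12 ⬝ᵥ w 15 = T 0 (k + 4) := V.dot H _ _ 0
    rw [cross_dot_cross, a1, a2, dotProduct_comm (w 12) (w 11), V.dot_one 11]
    ring
  have bc : w 22 ⨯₃ w 18 ⬝ᵥ w 1 ⨯₃ w 5 = -B5 T p k := by
    have h := H.B5_add k
    have a1 : w 22 ⬝ᵥ w 1 = T 0 k := by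
      rw [dotProduct_comm]; exact V.dot_dual H _ _ 0
    have a2 : w 18 ⬝ᵥ w 5 = T 4 k := by
      rw [dotProduct_comm]; exact V.dot_dual H _ _ 4
    have a3 : w 22 ⬝ᵥ w 5 = T 7 (k + 4) := by
      rw [dotProduct_comm]; exact V.dot H _ _ 7
    have a4 : w 18 ⬝ᵥ w 1 = T 7 (k - 4) := by
      rw [dotProduct_comm]; exact V.dot H _ _ 7
    rw [cross_dot_cross, a1, a2, a3, a4]
    linear_combination h
  have bd : w 22 ⨯₃ w 18 ⬝ᵥ w 15 ⨯₃ w 11 = B5 T p (k - 2) := by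
    have h := H.B5_add (k - 2)
    have a1 : w 22 ⬝ᵥ w 15 = T 7 (k - 2 + 4) := by
      rw [dotProduct_comm]; exact V.dot_dual H _ _ 7
    have a2 : w 18 ⬝ᵥ w 11 = T 7 (k - 2 - 4) := by
      rw [dotProduct_comm]; exact V.dot_dual H _ _ 7
    have a3 : w 22 ⬝ᵥ w 11 = T 4 (k - 2) := by
      rw [dotProduct_comm]; exact V.dot H _ _ 4
    have a4 : w 18 ⬝ᵥ w 15 = T 0 (k - 2) := by
      rw [dotProduct_comm]; exact V.dot H _ _ 0
    rw [cross_dot_cross, a1, a2, a3, a4]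
    linear_combination -h
  have bg : w 22 ⨯₃ w 18 ⬝ᵥ w 8 = -S4 T p (k - 1) := by
    rw [f2, dotProduct_comm]
    show tri (w 8) (w 22) (w 18) = _
    rw [tri_swap, ← tri_rotate (w 8)]
  have ec : w 15 ⬝ᵥ w 1 ⨯₃ w 5 = S4 T p (k + 1) := by
    rw [f1, ← tri_rotate (w 15)]; rfl
  have eg : w 15 ⬝ᵥ w 8 = T 7 k := by
    rw [dotProduct_comm]; exact V.dot_dual H _ _ 7
  have ag : w 8 ⨯₃ w 12 ⬝ᵥ w 8 = 0 := by rw [dotProduct_comm, dot_self_cross]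
  have ed : w 15 ⬝ᵥ w 15 ⨯₃ w 11 = 0 := dot_self_cross ..
  have h := H.S4_mul_S4 k
  -- With the two zero entries the Gram determinant is a product B5 · B5 · T_7 plus T_0 · T_0 times
  -- S4 · S4 - B5 · T_7, and the latter difference is S3 by the node 4 relation.
  rw [e1, e2, tri_mul_tri, ac, ad, ag, bc, bd, bg, ec, ed, eg]
  linear_combination T 0 (k - 4) * T 0 (k + 4) * h

/-- Cramer's rule expands w_15 in A = w_8 × w_12, B = w_22 × w_18 and C = w_8 × w_22. Pairing with n
= w_1 × w_5 gives the claim, because cross products of A, B with C are multiples of w_8, w_22. The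
identity holds for every n. -/
theorem S6_mul_B7 (H : IsFusion T p) (k : ℤ) : S6 T k * B7 T p k =
    S4 T p k * S4 T p (k + 2) * S4 T p (k - 2) -
      S4 T p (k + 2) * B5 T p (k - 1) * T 7 (k - 1) -
      S4 T p (k - 2) * B5 T p (k + 1) * T 7 (k + 1) := by
  obtain ⟨w, V⟩ := H.exists_isVec (k + 6)
  have e1 : B7 T p k = tri (w 8 ⨯₃ w 12) (w 22 ⨯₃ w 18) (w 15) :=
    H.B7_eq V 8 (by push_cast; omega)
  have f0 : S4 T p k = tri (w 1) (w 5) (w 15) := H.S4_eq V 0 (by push_cast; omega)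
  have f1 : S4 T p (k + 2) = tri (w 8) (w 12) (w 22) := H.S4_eq V 7 (by push_cast; omega)
  have f2 : S4 T p (k - 2) = tri (w 18) (w 22) (w 8) := H.S4_eq' V 8 (by push_cast; omega)
  have b1 : B5 T p (k + 1) = w 1 ⨯₃ w 5 ⬝ᵥ w 8 ⨯₃ w 12 := by
    have h := H.B5_add (k + 1)
    have a1 : w 1 ⬝ᵥ w 8 = T 7 (k + 1 - 4) := V.dot_dual H _ _ 7
    have a2 : w 5 ⬝ᵥ w 12 = T 7 (k + 1 + 4) := V.dot_dual H _ _ 7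
    have a3 : w 5 ⬝ᵥ w 8 = T 0 (k + 1) := V.dot H _ _ 0
    have a4 : w 1 ⬝ᵥ w 12 = T 4 (k + 1) := V.dot H _ _ 4
    rw [cross_dot_cross, a1, a2, a3, a4]
    linear_combination h
  have b2 : B5 T p (k - 1) = w 1 ⨯₃ w 5 ⬝ᵥ w 18 ⨯₃ w 22 := by
    have h := H.B5_add (k - 1)
    have a1 : w 1 ⬝ᵥ w 18 = T 7 (k - 1 - 4) := V.dot H _ _ 7
    have a2 : w 5 ⬝ᵥ w 22 = T 7 (k - 1 + 4) := V.dot H _ _ 7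
    have a3 : w 1 ⬝ᵥ w 22 = T 0 (k - 1) := V.dot_dual H _ _ 0
    have a4 : w 5 ⬝ᵥ w 18 = T 4 (k - 1) := V.dot_dual H _ _ 4
    rw [cross_dot_cross, a1, a2, a3, a4]
    linear_combination h
  have b3 : S6 T k = w 1 ⨯₃ w 5 ⬝ᵥ w 8 ⨯₃ w 22 := by
    have a1 : w 1 ⬝ᵥ w 8 = T 7 (k - 3) := V.dot_dual H _ _ 7
    have a2 : w 5 ⬝ᵥ w 22 = T 7 (k + 3) := V.dot H _ _ 7
    have a3 : w 1 ⬝ᵥ w 22 = T 0 (k - 1) := V.dot_dual H _ _ 0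
    have a4 : w 5 ⬝ᵥ w 8 = T 0 (k + 1) := V.dot H _ _ 0
    rw [cross_dot_cross, a1, a2, a3, a4, S6]
    ring
  have c1 : T 7 (k + 1) = w 15 ⬝ᵥ w 22 := (V.dot_dual H _ _ 7).symm
  have c2 : T 7 (k - 1) = w 15 ⬝ᵥ w 8 := by
    rw [dotProduct_comm]; exact (V.dot_dual H _ _ 7).symm
  have f0' : S4 T p k = w 1 ⨯₃ w 5 ⬝ᵥ w 15 := by
    rw [f0, ← tri_rotate (w 15), dotProduct_comm]; rfl
  rw [e1, f0', f1, f2, b1, b2, b3, c1, c2]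
  generalize w 1 ⨯₃ w 5 = n
  simp only [tri, cross_apply, vec3_dotProduct, cons_val_zero, cons_val_one, cons_val]
  ring

/-- The relation of the `D₄` related `T`-system at node `3` and level one. -/
theorem S3_mul_S3 (H : IsFusion T p) (k : ℤ) : S3 T (k + 1) * S3 T (k - 1) =
    B5 T p (k + 1) * B5 T p (k - 1) * (T 7 (k + 1) * T 7 (k - 1)) +
      S6 T k * B7 T p k * S4 T p k := by
  have h1 := H.S4_mul_S4 (k + 1)
  have h2 := H.S4_mul_S4 (k - 1)
  have h := H.S6_mul_B7 k
  rw [show k + 1 + 1 = k + 2 by ring, show k + 1 - 1 = k by ring] at h1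
  rw [show k - 1 - 1 = k - 2 by ring, show k - 1 + 1 = k by ring] at h2
  -- Both values of S3 are now S4 · S4 - B5 · T_7 with the common factor S4 k, and `S6_mul_B7`
  -- supplies the cross terms.
  rw [← sub_eq_iff_eq_add'] at h1 h2
  rw [← h1, ← h2, h]
  ring

/-- The relation of the `D₄` related `T`-system at node `1` and level two. -/
theorem T_mul_T (k : ℤ) : T 7 (k + 3) * T 7 (k - 3) = S6 T k + T 0 (k + 1) * T 0 (k - 1) := by
  rw [S6]; ring

/-- The relation of the `D₄` related `T`-system at node `2` and level two. -/
theorem B5_mul_B5 (H : IsFusion T p) (k : ℤ) : B5 T p (k + 3) * B5 T p (k - 3) =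
    B7 T p k * B3 T p k + T 0 (k + 5) * T 0 (k - 5) * (T 0 (k + 3) * T 0 (k - 3)) := by
  have e1 : B5 T p (k + 3) = (T 1 (k + 9) * T 1 (k + 3) * T 1 (k - 3) -
      T 1 (k + 9) * (T 0 (k + 11) * T 0 (k - 11)) -
      T 1 (k - 3) * (T 0 (k - 5) * T 0 (k + 17))) / (p (k + 24) * p (k - 18)) := by
    rw [B5]; ring_nf
  have e2 : B5 T p (k - 3) = (T 1 (k + 3) * T 1 (k - 3) * T 1 (k - 9) -
      T 1 (k + 3) * (T 0 (k + 5) * T 0 (k - 17)) -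
      T 1 (k - 9) * (T 0 (k - 11) * T 0 (k + 11))) / (p (k + 18) * p (k + 24)) := by
    rw [B5, H.p_mod (k := k - 3 - 21) (l := k + 24) (by omega)]; ring_nf
  have z1 : T 0 (k + 17) = p (k + 24) * p (k + 10) := H.T_zero' (by omega) (by omega)
  have z2 : T 0 (k + 11) = p (k + 18) * p (k + 4) := H.T_zero' (by omega) (by omega)
  have z3 : T 0 (k - 11) = p (k - 4) * p (k - 18) := H.T_zero' (by omega) (by omega)
  have z4 : T 0 (k - 17) = p (k - 10) * p (k + 24) := H.T_zero' (by omega) (by omega)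
  have z5 : T 0 (k + 3) = p (k + 10) * p (k - 4) := H.T_zero' (by omega) (by omega)
  have z6 : T 0 (k - 3) = p (k + 4) * p (k - 10) := H.T_zero' (by omega) (by omega)
  have h1 := H.p_ne (k + 24)
  have h2 := H.p_ne (k + 18)
  have h3 := H.p_ne (k - 18)
  -- Euler's identity for a continuant of length four (B7), its two end continuants of length three
  -- (B5) and its middle one (B3). The denominators agree because p (k - 24) = p (k + 24).
  rw [e1, e2, B7, B3, z1, z2, z3, z4, z5, z6]
  field_simp
  ring

end IsFusion

end Identities

/-! ### Row sums and their recursion in the length -/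

section Words

/-- The sum over the weakly increasing words of length `m` in letters at most `c`, where the
letter `l` in position `k` has weight `b k l`. -/
def wordSum {K : Type*} [CommSemiring K] (b : ℕ → Fin 3 → K) (m : ℕ) (c : Fin 3) : K :=
  open Classical in
  ∑ l : Fin m → Fin 3 with Monotone l ∧ ∀ k, l k ≤ c, ∏ k : Fin m, b k (l k)

theorem monotone_snoc {m : ℕ} (l : Fin m → Fin 3) (d : Fin 3) :
    Monotone (Fin.snoc l d : Fin (m + 1) → Fin 3) ↔ Monotone l ∧ ∀ k, l k ≤ d := by
  constructor
  · intro h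
    refine ⟨fun i j hij => ?_, fun k => ?_⟩
    · simpa using h (Fin.castSucc_le_castSucc_iff.2 hij)
    · simpa using h (Fin.le_last k.castSucc)
  · rintro ⟨h1, h2⟩ i j hij
    induction i using Fin.lastCases with
    | last =>
      obtain rfl : j = Fin.last m := le_antisymm (Fin.le_last j) hij
      exact le_rfl
    | cast i =>
      induction j using Fin.lastCases with
      | last => simpa using h2 i
      | cast j => simpa using h1 (Fin.castSucc_le_castSucc_iff.1 hij)

variable {K : Type*}

theorem wordSum_zero [CommSemiring K] (b : ℕ → Fin 3 → K) (c : Fin 3) : wordSum b 0 c = 1 := by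
  classical
  rw [wordSum, Finset.filter_true_of_mem]
  · simp
  · intro l _
    exact ⟨fun i => i.elim0, fun i => i.elim0⟩

/-- The last letter is the largest; once removed it bounds the remaining word, which is why the
bound is carried along. -/
theorem wordSum_succ [CommSemiring K] (b : ℕ → Fin 3 → K) (m : ℕ) (c : Fin 3) :
    wordSum b (m + 1) c = ∑ d ∈ Finset.Iic c, wordSum b m d * b m d := by
  classical
  simp only [wordSum, Finset.sum_mul]
  rw [Finset.sum_sigma', eq_comm]
  refine Finset.sum_bij' (fun x _ => (Fin.snoc x.2 x.1 : Fin (m + 1) → Fin 3))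
    (fun l _ => ⟨l (Fin.last m), Fin.init l⟩) ?_ ?_ ?_ ?_ ?_
  · rintro ⟨d, l⟩ h
    simp only [Finset.mem_sigma, Finset.mem_Iic, Finset.mem_filter, Finset.mem_univ,
      true_and] at h ⊢
    refine ⟨(monotone_snoc l d).2 h.2, fun k => ?_⟩
    induction k using Fin.lastCases with
    | last => simpa using h.1
    | cast k => simpa using (h.2.2 k).trans h.1
  · intro l h
    simp only [Finset.mem_sigma, Finset.mem_Iic, Finset.mem_filter, Finset.mem_univ,
      true_and] at h ⊢
    refine ⟨h.2 _, (monotone_snoc _ _).1 ?_⟩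
    rw [Fin.snoc_init_self]
    exact h.1
  · rintro ⟨d, l⟩ _
    simp
  · intro l _
    simp
  · rintro ⟨d, l⟩ _
    simp [Fin.prod_univ_castSucc]

theorem wordSum_succ_zero [CommSemiring K] (b : ℕ → Fin 3 → K) (m : ℕ) :
    wordSum b (m + 1) 0 = wordSum b m 0 * b m 0 := by
  rw [wordSum_succ, show Finset.Iic (0 : Fin 3) = {0} from rfl, Finset.sum_singleton]

theorem wordSum_succ_one [CommSemiring K] (b : ℕ → Fin 3 → K) (m : ℕ) :
    wordSum b (m + 1) 1 = wordSum b (m + 1) 0 + wordSum b m 1 * b m 1 := by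
  rw [wordSum_succ, wordSum_succ_zero, show Finset.Iic (1 : Fin 3) = {0, 1} from rfl,
    Finset.sum_pair (by decide)]

theorem wordSum_succ_two [CommSemiring K] (b : ℕ → Fin 3 → K) (m : ℕ) :
    wordSum b (m + 1) 2 = wordSum b (m + 1) 1 + wordSum b m 2 * b m 2 := by
  rw [wordSum_succ, wordSum_succ_one, wordSum_succ_zero,
    show Finset.Iic (2 : Fin 3) = {0, 1, 2} from rfl,
    Finset.sum_insert (by decide), Finset.sum_pair (by decide)]
  ring

theorem wordSum_one [CommSemiring K] (b : ℕ → Fin 3 → K) :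
    wordSum b 1 2 = b 0 0 + b 0 1 + b 0 2 := by
  rw [wordSum_succ_two, wordSum_succ_one, wordSum_succ_zero]
  simp [wordSum_zero]

theorem wordSum_two [CommRing K] (b : ℕ → Fin 3 → K) :
    wordSum b 2 2 = (b 1 0 + b 1 1 + b 1 2) * wordSum b 1 2 -
      (b 0 1 * b 1 0 + b 0 2 * b 1 0 + b 0 2 * b 1 1) := by
  rw [wordSum_succ_two, wordSum_succ_one, wordSum_succ_zero, wordSum_succ_two, wordSum_succ_one,
    wordSum_succ_zero]
  simp only [wordSum_zero]
  ring

/-- A position-dependent form of the alternating relation between complete and elementary symmetric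
functions: the coefficients sum over strictly decreasing words of lengths one to three, that is,
over columns. -/
theorem wordSum_add_three [CommRing K] (b : ℕ → Fin 3 → K) (m : ℕ) :
    wordSum b (m + 3) 2 = (b (m + 2) 0 + b (m + 2) 1 + b (m + 2) 2) * wordSum b (m + 2) 2 -
      (b (m + 1) 1 * b (m + 2) 0 + b (m + 1) 2 * b (m + 2) 0 + b (m + 1) 2 * b (m + 2) 1) *
        wordSum b (m + 1) 2 +
      b m 2 * b (m + 1) 1 * b (m + 2) 0 * wordSum b m 2 := by
  have h3 := wordSum_succ_two b (m + 2)
  have h3' := wordSum_succ_one b (m + 2)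
  have h3'' := wordSum_succ_zero b (m + 2)
  have h2 := wordSum_succ_two b (m + 1)
  have h2' := wordSum_succ_one b (m + 1)
  have h1 := wordSum_succ_two b m
  simp only [add_assoc, Nat.reduceAdd] at *
  linear_combination h3 + h3' + h3'' - b (m + 2) 0 * h2 - b (m + 2) 0 * h2' -
    b (m + 2) 1 * h2 + b (m + 1) 1 * b (m + 2) 0 * h1

end Words

namespace Data

variable (D : Data)

theorem rowSum_eq (m : ℕ) (x : ℂ) :
    D.rowSum m x = wordSum (fun k l => D.box l (x + I * (2 * (k : ℂ) - (m : ℂ) + 1))) m 2 := by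
  rw [rowSum, wordSum]
  refine Finset.sum_congr (Finset.filter_congr fun l _ => ?_) fun _ _ => rfl
  exact (and_iff_left fun k => Fin.le_last (l k)).symm

end Data

/-! ### Non-vanishing and quasi-periodicity of the theta function -/

section Theta

theorem integral_jacobiTheta₂_term (n : ℤ) (τ : ℂ) :
    ∫ x in (0 : ℝ)..1, jacobiTheta₂_term n x τ = if n = 0 then 1 else 0 := by
  split_ifs with hn
  · simp [jacobiTheta₂_term, hn]
  · have hc : 2 * Real.pi * I * n ≠ 0 := by simp [Real.pi_ne_zero, hn]
    have h : ∀ x : ℝ, jacobiTheta₂_term n x τ =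
        exp (Real.pi * I * n ^ 2 * τ) * exp (2 * Real.pi * I * n * x) := by
      intro x
      rw [jacobiTheta₂_term, exp_add, mul_comm]
    simp_rw [h]
    rw [intervalIntegral.integral_const_mul, integral_exp_mul_complex hc]
    have h1 : exp (2 * Real.pi * I * n * (1 : ℝ)) = 1 := by
      rw [exp_eq_one_iff]
      exact ⟨n, by push_cast; ring⟩
    rw [h1]
    simp

/-- Termwise integration picks out the constant Fourier coefficient; this rules out identical
vanishing without locating any zero. -/
theorem integral_jacobiTheta₂ {τ : ℂ} (hτ : 0 < τ.im) :
    ∫ x in (0 : ℝ)..1, jacobiTheta₂ x τ = 1 := by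
  have hnorm : ∀ (n : ℤ) (x : ℝ), ‖jacobiTheta₂_term n x τ‖ = ‖jacobiTheta₂_term n 0 τ‖ := by
    intro n x
    simp [norm_jacobiTheta₂_term]
  have hcont : ∀ n : ℤ, Continuous fun x : ℝ => jacobiTheta₂_term n x τ := by
    intro n
    unfold jacobiTheta₂_term
    fun_prop
  have hs : Summable fun n : ℤ => ‖jacobiTheta₂_term n 0 τ‖ :=
    ((summable_jacobiTheta₂_term_iff 0 τ).2 hτ).norm
  have h := MeasureTheory.hasSum_integral_of_summable_integral_norm
    (μ := MeasureTheory.volume.restrict (Set.Ioc (0 : ℝ) 1))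
    (F := fun (n : ℤ) (x : ℝ) => jacobiTheta₂_term n x τ)
    (fun n => ((hcont n).integrableOn_Icc).mono_set Set.Ioc_subset_Icc_self)
    (by simpa [hnorm] using hs)
  have e : ∀ n : ℤ, ∫ x in Set.Ioc (0 : ℝ) 1, jacobiTheta₂_term n x τ =
      if n = 0 then 1 else 0 := by
    intro n
    rw [← intervalIntegral.integral_of_le zero_le_one, integral_jacobiTheta₂_term]
  simp_rw [e] at h
  rw [intervalIntegral.integral_of_le zero_le_one]
  exact h.unique (hasSum_ite_eq 0 1)

theorem exists_jacobiTheta₂_ne_zero {τ : ℂ} (hτ : 0 < τ.im) : ∃ z, jacobiTheta₂ z τ ≠ 0 := by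
  by_contra! h
  have := integral_jacobiTheta₂ hτ
  simp [h] at this

theorem differentiable_theta₁ {τ : ℂ} (hτ : 0 < τ.im) : Differentiable ℂ (theta₁ τ) := by
  intro z
  have h := (differentiableAt_jacobiTheta₂_fst (z / Real.pi + (1 + τ) / 2) hτ).comp z
    (f := fun z : ℂ => z / Real.pi + (1 + τ) / 2) (by fun_prop)
  unfold theta₁
  exact DifferentiableAt.mul (by fun_prop) h

theorem exists_theta₁_ne_zero {τ : ℂ} (hτ : 0 < τ.im) : ∃ z, theta₁ τ z ≠ 0 := by
  obtain ⟨z, hz⟩ := exists_jacobiTheta₂_ne_zero hτ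
  refine ⟨(z - (1 + τ) / 2) * Real.pi, ?_⟩
  have hpi : (Real.pi : ℂ) ≠ 0 := by exact_mod_cast Real.pi_ne_zero
  rw [theta₁, mul_div_cancel_right₀ _ hpi, sub_add_cancel]
  exact mul_ne_zero (mul_ne_zero (by simp) (exp_ne_zero _)) hz

theorem theta₁_sub_pi (τ z : ℂ) : theta₁ τ (z - Real.pi) = -theta₁ τ z := by
  have hpi : (Real.pi : ℂ) ≠ 0 := by exact_mod_cast Real.pi_ne_zero
  have h : (z - Real.pi) / Real.pi + (1 + τ) / 2 + 1 = z / Real.pi + (1 + τ) / 2 := by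
    field_simp; ring
  rw [theta₁, theta₁, ← h, jacobiTheta₂_add_left,
    show Real.pi * I * τ / 4 + I * (z - Real.pi) =
      (Real.pi * I * τ / 4 + I * z) - Real.pi * I by ring, exp_sub, exp_pi_mul_I]
  ring

end Theta

/-! ### Translation of codiscrete sets, periodicity, and non-vanishing of φ and Q -/

theorem eventually_codiscrete_add {P : ℂ → Prop} (h : ∀ᶠ x in codiscrete ℂ, P x) (c : ℂ) :
    ∀ᶠ x in codiscrete ℂ, P (x + c) := by
  have h' := mem_codiscreteWithin_iff_forall_mem_nhdsNE.1 h
  refine mem_codiscreteWithin_iff_forall_mem_nhdsNE.2 fun x hx => ?_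
  have ht : Tendsto (fun y : ℂ => y + c) (nhdsWithin x {x}ᶜ) (nhdsWithin (x + c) {x + c}ᶜ) := by
    refine tendsto_nhdsWithin_iff.2 ⟨?_, ?_⟩
    · exact ((continuous_add_const c).tendsto x).mono_left nhdsWithin_le_nhds
    · filter_upwards [self_mem_nhdsWithin] with y hy
      simpa using hy
  have h2 := h' (x + c) trivial
  rw [Set.compl_univ, Set.union_empty] at h2 ⊢
  exact ht h2

namespace Data

variable (D : Data)

/-- Since λP = π, the argument of ϑ₁ moves by -π. The sign disappears in φ, where h occurs in pairs,
and in Q, where N is even. -/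
theorem h_add_period (x : ℂ) : D.h (x + period * I) = -D.h x := by
  have h : I * crossing * (x + period * I) = I * crossing * x - Real.pi := by
    rw [crossing, period]
    push_cast
    linear_combination (Real.pi : ℂ) * I_sq
  rw [Data.h, h, theta₁_sub_pi, Data.h]

theorem φ_add_period (x : ℂ) : D.φ (x + period * I) = D.φ x := by
  have e : ∀ c, x + period * I + c = x + c + period * I := fun c => add_right_comm _ _ _
  simp only [φ, pm, e, add_sub_right_comm x, D.h_add_period, neg_mul_neg]

theorem Q_add_period (hN : Even D.N) (x : ℂ) : D.Q (x + period * I) = D.Q x := by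
  simp only [Q, add_sub_right_comm x, D.h_add_period, Finset.prod_neg]
  simp [hN.neg_one_pow]

theorem box_add_period (hN : Even D.N) (l : Fin 3) (x : ℂ) :
    D.box l (x + period * I) = D.box l x := by
  have e : ∀ c, x + period * I + c = x + c + period * I := fun c => add_right_comm _ _ _
  simp only [box, e, add_sub_right_comm x, D.φ_add_period, D.Q_add_period hN]

theorem T_add_period (hN : Even D.N) (m : ℤ) (x : ℂ) : D.T m (x + period * I) = D.T m x := by
  have e : ∀ c, x + period * I + c = x + c + period * I := fun c => add_right_comm _ _ _
  have hf : ∀ m, D.f m (x + period * I) = D.f m x := by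
    intro m
    simp only [f, pm, e, add_sub_right_comm x, D.φ_add_period]
  match m with
  | .ofNat 0 => exact hf 2
  | .ofNat (m + 1) =>
    simp only [T, rowSum, hf, e, D.box_add_period hN]
  | .negSucc _ => rfl

variable {D}

theorem differentiable_h (hτ : 0 < D.τ.im) : Differentiable ℂ D.h :=
  (differentiable_theta₁ hτ).comp (by fun_prop)

theorem eventually_h_ne_zero (hτ : 0 < D.τ.im) : ∀ᶠ x in codiscrete ℂ, D.h x ≠ 0 := by
  obtain ⟨z, hz⟩ := exists_theta₁_ne_zero hτ
  have hc : I * (crossing : ℂ) ≠ 0 := by simp [crossing, Real.pi_ne_zero]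
  have hz' : D.h (z / (I * crossing)) ≠ 0 := by rwa [Data.h, mul_div_cancel₀ _ hc]
  exact AnalyticOnNhd.preimage_zero_mem_codiscrete
    (fun x _ => (differentiable_h hτ).analyticAt x) hz'

theorem eventually_Q_ne_zero (hτ : 0 < D.τ.im) : ∀ᶠ x in codiscrete ℂ, D.Q x ≠ 0 := by
  have h : ∀ᶠ x in codiscrete ℂ, ∀ j, D.h (x + -D.root j) ≠ 0 :=
    eventually_all.2 fun j => eventually_codiscrete_add (eventually_h_ne_zero hτ) _
  filter_upwards [h] with x hx
  rw [Q, Finset.prod_ne_zero_iff]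
  exact fun j _ => by simpa [sub_eq_add_neg] using hx j

theorem eventually_φ_ne_zero (hτ : 0 < D.τ.im) (h0 : ∃ x, D.φ x ≠ 0) :
    ∀ᶠ x in codiscrete ℂ, D.φ x ≠ 0 := by
  obtain ⟨x, hx⟩ := h0
  refine AnalyticOnNhd.preimage_zero_mem_codiscrete (fun x _ => ?_) hx
  have hd : Differentiable ℂ D.φ := by
    have := differentiable_h hτ
    unfold φ pm
    fun_prop
  exact hd.analyticAt x

/-! ### Boxes on the lattice, columns, and the recursion for T_m -/

variable (D)

/-- The point of the lattice of step `i/14` through `x` with index `k`. -/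
def pt (x : ℂ) (k : ℤ) : ℂ := x + I * ((k : ℂ) / 14)

theorem pt_add (x : ℂ) (k l : ℤ) (c : ℂ) (h : c = l / 14) : pt x k + c * I = pt x (k + l) := by
  simp only [pt]; rw [h]; push_cast; ring

theorem pt_sub (x : ℂ) (k l : ℤ) (c : ℂ) (h : c = l / 14) : pt x k - c * I = pt x (k - l) := by
  simp only [pt]; rw [h]; push_cast; ring

theorem box_zero_pt (x : ℂ) (k : ℤ) : D.box 0 (pt x k) =
    D.w * D.φ (pt x (k + 21)) * D.φ (pt x (k + 7)) *
      (D.Q (pt x (k - 35)) / D.Q (pt x (k - 7))) := by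
  simp only [box, Matrix.cons_val_zero]
  rw [pt_add x k 21 _ (by norm_num), pt_add x k 7 _ (by norm_num), pt_sub x k 35 _ (by norm_num),
    pt_sub x k 7 _ (by norm_num)]

theorem box_one_pt (x : ℂ) (k : ℤ) : D.box 1 (pt x k) =
    D.φ (pt x (k + 21)) * D.φ (pt x (k - 21)) *
      (D.Q (pt x (k - 21)) * D.Q (pt x (k + 21)) /
        (D.Q (pt x (k - 7)) * D.Q (pt x (k + 7)))) := by
  simp only [box, Matrix.cons_val_one, Matrix.cons_val_zero]
  rw [pt_add x k 21 _ (by norm_num), pt_add x k 7 _ (by norm_num), pt_sub x k 21 _ (by norm_num),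
    pt_sub x k 7 _ (by norm_num)]

theorem box_two_pt (x : ℂ) (k : ℤ) : D.box 2 (pt x k) =
    D.w⁻¹ * D.φ (pt x (k - 21)) * D.φ (pt x (k - 7)) *
      (D.Q (pt x (k + 35)) / D.Q (pt x (k + 7))) := by
  simp only [box, Matrix.cons_val]
  rw [pt_sub x k 21 _ (by norm_num), pt_sub x k 7 _ (by norm_num), pt_add x k 35 _ (by norm_num),
    pt_add x k 7 _ (by norm_num)]

theorem w_ne_zero : D.w ≠ 0 := exp_ne_zero _

variable {D}

/-- The sum over the columns of height two is the sum over the boxes up to a vacuum factor. -/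
theorem column_two {x : ℂ} (hQ : ∀ k, D.Q (pt x k) ≠ 0) {k a b : ℤ} (ha : a = k - 14)
    (hb : b = k + 14) :
    D.box 1 (pt x a) * D.box 0 (pt x b) + D.box 2 (pt x a) * D.box 0 (pt x b) +
      D.box 2 (pt x a) * D.box 1 (pt x b) =
    D.φ (pt x (k + 35)) * D.φ (pt x (k - 35)) *
      (D.box 0 (pt x k) + D.box 1 (pt x k) + D.box 2 (pt x k)) := by
  subst ha hb
  have hw := D.w_ne_zero
  simp only [box_zero_pt, box_one_pt, box_two_pt]
  have q1 := hQ (k - 7)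
  have q2 := hQ (k + 7)
  have q3 := hQ (k - 21)
  have q4 := hQ (k + 21)
  rw [show k - 14 + 21 = k + 7 by ring, show k - 14 - 21 = k - 35 by ring,
    show k - 14 - 7 = k - 21 by ring, show k - 14 + 7 = k - 7 by ring,
    show k - 14 + 35 = k + 21 by ring, show k + 14 - 21 = k - 7 by ring,
    show k + 14 + 21 = k + 35 by ring, show k + 14 - 7 = k + 7 by ring,
    show k + 14 + 7 = k + 21 by ring, show k + 14 - 35 = k - 21 by ring]
  -- Columns match boxes one by one: after cancelling Q, letters (1, 0), (2, 0), (2, 1) give boxes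
  -- 0, 1, 2 times the same vacuum factor.
  field_simp

/-- The column of height three is a product of vacuum factors. -/
theorem column_three {x : ℂ} (hQ : ∀ k, D.Q (pt x k) ≠ 0) {k a b : ℤ} (ha : a = k - 28)
    (hb : b = k + 28) :
    D.box 2 (pt x a) * D.box 1 (pt x k) * D.box 0 (pt x b) =
    D.φ (pt x (k + 21)) * D.φ (pt x (k - 21)) * (D.φ (pt x (k + 35)) * D.φ (pt x (k - 35))) *
      (D.φ (pt x (k + 49)) * D.φ (pt x (k - 49))) := by
  subst ha hb
  have hw := D.w_ne_zero
  simp only [box_zero_pt, box_one_pt, box_two_pt]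
  have q1 := hQ (k - 7)
  have q2 := hQ (k + 7)
  have q3 := hQ (k - 21)
  have q4 := hQ (k + 21)
  rw [show k - 28 - 21 = k - 49 by ring, show k - 28 - 7 = k - 35 by ring,
    show k - 28 + 35 = k + 7 by ring, show k - 28 + 7 = k - 21 by ring,
    show k + 28 + 21 = k + 49 by ring, show k + 28 + 7 = k + 35 by ring,
    show k + 28 - 35 = k - 7 by ring, show k + 28 - 7 = k + 21 by ring]
  field_simp

variable (D)

/-- The weight of the letter `l` in position `j` of a row whose left end stands at index `s`. -/
def rowWeight (x : ℂ) (s : ℤ) (j : ℕ) (l : Fin 3) : ℂ := D.box l (pt x (s + 28 * j))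

theorem rowSum_pt (x : ℂ) (k : ℤ) (m : ℕ) :
    D.rowSum m (pt x k) = wordSum (D.rowWeight x (k - 14 * (m - 1))) m 2 := by
  rw [rowSum_eq]
  congr 1
  ext j l
  simp only [rowWeight, pt]
  congr 1
  push_cast
  ring

theorem f_two_pt (x : ℂ) (k : ℤ) : D.f 2 (pt x k) = D.φ (pt x (k + 7)) * D.φ (pt x (k - 7)) := by
  simp only [f, pm, Nat.reduceSub, Finset.Icc_self, Finset.prod_singleton]
  congr 2 <;> (simp only [pt]; push_cast; ring)

theorem f_eq (n : ℕ) (y : ℂ) : D.f (n + 1) y =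
    (∏ i ∈ Finset.range n, D.φ (y + I * ((i : ℂ) + 1 / 2))) *
      ∏ i ∈ Finset.range n, D.φ (y - I * ((i : ℂ) + 1 / 2)) := by
  rw [f, ← Finset.prod_mul_distrib, Nat.add_sub_cancel, ← Finset.Ico_add_one_right_eq_Icc,
    Finset.prod_Ico_eq_prod_range, Nat.add_sub_cancel, ← Finset.prod_range_reflect]
  refine Finset.prod_congr rfl fun j hj => ?_
  rw [Finset.mem_range] at hj
  have h : ((1 + (n - 1 - j) : ℕ) : ℂ) = n - j := by
    rw [show 1 + (n - 1 - j) = n - j by omega, Nat.cast_sub (by omega)]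
  rw [pm, h]
  push_cast
  congr 3 <;> ring

/-- Adding a box on the right fixes the left end and moves the centre by i, so only two vacuum
factors are new. This converts the recursion for row sums into the one for T_m. -/
theorem f_succ (n : ℕ) (y : ℂ) : D.f (n + 2) (y + I) =
    D.f (n + 1) y * (D.φ (y + I * ((n : ℂ) + 1 / 2)) * D.φ (y + I * ((n : ℂ) + 3 / 2))) := by
  have h1 : ∏ i ∈ Finset.range (n + 1), D.φ (y + I - I * ((i : ℂ) + 1 / 2)) =
      (∏ i ∈ Finset.range n, D.φ (y - I * ((i : ℂ) + 1 / 2))) * D.φ (y + I * (1 / 2)) := by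
    rw [Finset.prod_range_succ']
    congr 1
    · refine Finset.prod_congr rfl fun i _ => ?_
      push_cast; congr 1; ring
    · push_cast; congr 1; ring
  have h2 : D.φ (y + I * (1 / 2)) *
      ∏ i ∈ Finset.range (n + 1), D.φ (y + I + I * ((i : ℂ) + 1 / 2)) =
      (∏ i ∈ Finset.range n, D.φ (y + I * ((i : ℂ) + 1 / 2))) *
        (D.φ (y + I * ((n : ℂ) + 1 / 2)) * D.φ (y + I * ((n : ℂ) + 3 / 2))) := by
    have h := Finset.prod_range_succ' (fun i : ℕ => D.φ (y + I * ((i : ℂ) + 1 / 2))) (n + 1)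
    rw [Finset.prod_range_succ, Finset.prod_range_succ] at h
    rw [← mul_assoc, mul_comm]
    convert h.symm using 2
    · refine Finset.prod_congr rfl fun i _ => ?_
      push_cast; congr 1; ring
    · simp
    · push_cast; congr 3; ring
  rw [show n + 2 = n + 1 + 1 by ring, f_eq, f_eq, h1]
  linear_combination (∏ i ∈ Finset.range n, D.φ (y - I * ((i : ℂ) + 1 / 2))) * h2

theorem T_neg {m : ℤ} (hm : m < 0) (x : ℂ) : D.T m x = 0 := by
  match m, hm with
  | .negSucc _, _ => rfl

theorem T_zero_pt (x : ℂ) (k : ℤ) :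
    D.T 0 (pt x k) = D.φ (pt x (k + 7)) * D.φ (pt x (k - 7)) := D.f_two_pt x k

theorem T_natCast_pt (x : ℂ) (n : ℕ) (k s : ℤ) (h : s = k - 14 * n) :
    D.T (n + 1) (pt x k) = wordSum (D.rowWeight x s) (n + 1) 2 / D.f (n + 1) (pt x k) := by
  have h1 := D.rowSum_pt x k (n + 1)
  rw [show k - 14 * (((n + 1 : ℕ) : ℤ) - 1) = s by rw [h]; push_cast; ring] at h1
  rw [← h1]
  rfl

theorem T_one_pt (x : ℂ) (k : ℤ) :
    D.T 1 (pt x k) = D.box 0 (pt x k) + D.box 1 (pt x k) + D.box 2 (pt x k) := by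
  have h := D.T_natCast_pt x 0 k k (by simp)
  have hf : D.f (0 + 1) (pt x k) = 1 := by simp [f]
  rw [hf, div_one] at h
  simpa [wordSum_one, rowWeight] using h

theorem f_succ_pt (x : ℂ) (n : ℕ) (k l a b : ℤ) (hl : l = k - 14) (ha : a = k + 14 * n - 7)
    (hb : b = k + 14 * n + 7) : D.f (n + 2) (pt x k) =
      D.f (n + 1) (pt x l) * (D.φ (pt x a) * D.φ (pt x b)) := by
  have h := D.f_succ n (pt x l)
  have e1 : pt x l + I = pt x k := by rw [hl]; simp only [pt]; push_cast; ring
  have e2 : pt x l + I * ((n : ℂ) + 1 / 2) = pt x a := by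
    rw [hl, ha]; simp only [pt]; push_cast; ring
  have e3 : pt x l + I * ((n : ℂ) + 3 / 2) = pt x b := by
    rw [hl, hb]; simp only [pt]; push_cast; ring
  rwa [e1, e2, e3] at h

variable {D}

theorem f_ne_zero {x : ℂ} (hφ : ∀ k, D.φ (pt x k) ≠ 0) (n : ℕ) (k : ℤ) :
    D.f (n + 1) (pt x k) ≠ 0 := by
  induction n generalizing k with
  | zero => simp [f]
  | succ n ih =>
    rw [D.f_succ_pt x n k _ _ _ rfl rfl rfl]
    exact mul_ne_zero (ih _) (mul_ne_zero (hφ _) (hφ _))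

theorem T_rec_two {x : ℂ} (hφ : ∀ k, D.φ (pt x k) ≠ 0) (hQ : ∀ k, D.Q (pt x k) ≠ 0) (k : ℤ) :
    D.T 2 (pt x k) =
      D.T 1 (pt x (k + 14)) / (D.φ (pt x (k - 7)) * D.φ (pt x (k + 7))) * D.T 1 (pt x (k - 14)) -
      D.T 1 (pt x k) * D.φ (pt x (k + 35)) /
        (D.φ (pt x (k - 21)) * D.φ (pt x (k - 7)) * D.φ (pt x (k + 7))) *
          D.T 0 (pt x (k - 28)) := by
  have h := D.T_natCast_pt x 1 k (k - 14) (by simp)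
  rw [D.f_two_pt, wordSum_two, wordSum_one] at h
  simp only [rowWeight, Nat.cast_zero, Nat.cast_one, mul_zero, mul_one, add_zero] at h
  rw [show k - 14 + 28 = k + 14 by ring, column_two hQ (k := k) rfl rfl, ← T_one_pt, ← T_one_pt,
    ← T_one_pt] at h
  have h1 := hφ (k - 7)
  have h2 := hφ (k + 7)
  have h3 := hφ (k - 21)
  rw [show (2 : ℤ) = 1 + 1 by norm_num, h, T_zero_pt, show k - 28 + 7 = k - 21 by ring,
    show k - 28 - 7 = k - 35 by ring]
  field_simp

/-- All rows share the left end s; l is the position of the third box from the right in the longest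
one. -/
theorem wordSum_rowWeight {x : ℂ} (hQ : ∀ k, D.Q (pt x k) ≠ 0) (s l : ℤ) (n : ℕ)
    (h : l = s + 28 * n) : wordSum (D.rowWeight x s) (n + 3) 2 =
      D.T 1 (pt x (l + 56)) * wordSum (D.rowWeight x s) (n + 2) 2 -
      D.φ (pt x (l + 77)) * D.φ (pt x (l + 7)) * D.T 1 (pt x (l + 42)) *
        wordSum (D.rowWeight x s) (n + 1) 2 +
      D.φ (pt x (l + 49)) * D.φ (pt x (l + 7)) * (D.φ (pt x (l + 63)) * D.φ (pt x (l - 7))) *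
        (D.φ (pt x (l + 77)) * D.φ (pt x (l - 21))) * wordSum (D.rowWeight x s) n 2 := by
  have e0 : s + 28 * (n : ℤ) = l := h.symm
  have e1 : s + 28 * ((n + 1 : ℕ) : ℤ) = l + 28 := by rw [h]; push_cast; ring
  have e2 : s + 28 * ((n + 2 : ℕ) : ℤ) = l + 56 := by rw [h]; push_cast; ring
  have c2 := column_two hQ (k := l + 42) (a := l + 28) (b := l + 56) (by ring) (by ring)
  have c3 := column_three hQ (k := l + 28) (a := l) (b := l + 56) (by ring) (by ring)
  rw [show l + 42 + 35 = l + 77 by ring, show l + 42 - 35 = l + 7 by ring, ← T_one_pt] at c2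
  rw [show l + 28 + 21 = l + 49 by ring, show l + 28 - 21 = l + 7 by ring,
    show l + 28 + 35 = l + 63 by ring, show l + 28 - 35 = l - 7 by ring,
    show l + 28 + 49 = l + 77 by ring, show l + 28 - 49 = l - 21 by ring] at c3
  rw [wordSum_add_three]
  simp only [rowWeight, e0, e1, e2]
  rw [c2, c3, ← T_one_pt]

theorem T_rec_three {x : ℂ} (hφ : ∀ k, D.φ (pt x k) ≠ 0) (hQ : ∀ k, D.Q (pt x k) ≠ 0) (k : ℤ) :
    D.T 3 (pt x k) =
      D.T 1 (pt x (k + 28)) / (D.φ (pt x (k + 7)) * D.φ (pt x (k + 21))) * D.T 2 (pt x (k - 14)) -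
      D.T 1 (pt x (k + 14)) * D.φ (pt x (k + 49)) /
        (D.φ (pt x (k - 7)) * D.φ (pt x (k + 7)) * D.φ (pt x (k + 21))) * D.T 1 (pt x (k - 28)) +
      D.φ (pt x (k + 35)) * D.φ (pt x (k + 49)) / (D.φ (pt x (k - 7)) * D.φ (pt x (k + 7))) *
        D.T 0 (pt x (k - 42)) := by
  have h3 := D.T_natCast_pt x 2 k (k - 28) (by norm_num)
  have h2 := D.T_natCast_pt x 1 (k - 14) (k - 28) (by ring)
  have h1 := D.T_natCast_pt x 0 (k - 28) (k - 28) (by ring)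
  have hf : D.f (0 + 1) (pt x (k - 28)) = 1 := by simp [f]
  have f2 := D.f_two_pt x (k - 14)
  have f3 := D.f_succ_pt x 1 k _ (k + 7) (k + 21) rfl (by push_cast; ring)
    (by push_cast; ring)
  rw [hf, div_one] at h1
  have r := wordSum_rowWeight hQ (k - 28) (k - 28) 0 (by simp)
  simp only [Nat.cast_zero, Nat.cast_one, zero_add, Nat.reduceAdd, Nat.cast_ofNat,
    Int.reduceAdd] at h1 h2 h3 f2 f3 r
  rw [wordSum_zero, show k - 28 + 56 = k + 28 by ring, show k - 28 + 77 = k + 49 by ring,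
    show k - 28 + 42 = k + 14 by ring, show k - 28 + 49 = k + 21 by ring,
    show k - 28 + 63 = k + 35 by ring, show k - 28 + 7 = k - 21 by ring,
    show k - 28 - 7 = k - 35 by ring, show k - 28 - 21 = k - 49 by ring] at r
  rw [show k - 14 + 7 = k - 7 by ring, show k - 14 - 7 = k - 21 by ring] at f2
  have p1 := hφ (k - 7)
  have p2 := hφ (k + 7)
  have p3 := hφ (k - 21)
  have p4 := hφ (k + 21)
  rw [h3, h2, h1, f3, f2, r, T_zero_pt, show k - 42 + 7 = k - 35 by ring,
    show k - 42 - 7 = k - 49 by ring]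
  field_simp

theorem T_rec_add_four {x : ℂ} (hφ : ∀ k, D.φ (pt x k) ≠ 0) (hQ : ∀ k, D.Q (pt x k) ≠ 0)
    (n : ℕ) (k l : ℤ) (hl : l = k + 14 * n) :
    D.T (n + 4) (pt x k) =
      D.T 1 (pt x (l + 42)) / (D.φ (pt x (l + 21)) * D.φ (pt x (l + 35))) *
        D.T (n + 3) (pt x (k - 14)) -
      D.T 1 (pt x (l + 28)) * D.φ (pt x (l + 63)) /
        (D.φ (pt x (l + 7)) * D.φ (pt x (l + 21)) * D.φ (pt x (l + 35))) *
        D.T (n + 2) (pt x (k - 28)) +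
      D.φ (pt x (l + 49)) * D.φ (pt x (l + 63)) / (D.φ (pt x (l + 7)) * D.φ (pt x (l + 21))) *
        D.T (n + 1) (pt x (k - 42)) := by
  have h4 := D.T_natCast_pt x (n + 3) k (k - 14 * n - 42) (by push_cast; ring)
  have h3 := D.T_natCast_pt x (n + 2) (k - 14) (k - 14 * n - 42) (by push_cast; ring)
  have h2 := D.T_natCast_pt x (n + 1) (k - 28) (k - 14 * n - 42) (by push_cast; ring)
  have h1 := D.T_natCast_pt x n (k - 42) (k - 14 * n - 42) (by ring)
  have f4 := D.f_succ_pt x (n + 2) k (k - 14) (l + 21) (l + 35) (by ring)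
    (by rw [hl]; push_cast; ring) (by rw [hl]; push_cast; ring)
  have f3 := D.f_succ_pt x (n + 1) (k - 14) (k - 28) (l - 7) (l + 7) (by ring)
    (by rw [hl]; push_cast; ring) (by rw [hl]; push_cast; ring)
  have f2 := D.f_succ_pt x n (k - 28) (k - 42) (l - 35) (l - 21) (by ring)
    (by rw [hl]; ring) (by rw [hl]; ring)
  have r := wordSum_rowWeight hQ (k - 14 * n - 42) (l - 14) (n + 1) (by rw [hl]; push_cast; ring)
  rw [show l - 14 + 56 = l + 42 by ring, show l - 14 + 77 = l + 63 by ring,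
    show l - 14 + 42 = l + 28 by ring, show l - 14 + 49 = l + 35 by ring,
    show l - 14 + 63 = l + 49 by ring, show l - 14 + 7 = l - 7 by ring,
    show l - 14 - 7 = l - 21 by ring, show l - 14 - 21 = l - 35 by ring] at r
  simp only [add_assoc, Nat.reduceAdd, Nat.cast_add, Nat.cast_one, Nat.cast_ofNat,
    Int.reduceAdd] at h1 h2 h3 h4 f2 f3 f4 r
  have p0 := f_ne_zero hφ n (k - 42)
  have p1 := hφ (l + 21)
  have p2 := hφ (l + 35)
  have p3 := hφ (l - 7)
  have p4 := hφ (l + 7)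
  have p5 := hφ (l - 35)
  have p6 := hφ (l - 21)
  rw [h4, h3, h2, h1, f4, f3, f2, r]
  field_simp

theorem isFusion {x : ℂ} (hφ : ∀ k, D.φ (pt x k) ≠ 0) (hQ : ∀ k, D.Q (pt x k) ≠ 0)
    (hd : ∀ m k : ℤ, 0 ≤ m → m ≤ 10 → D.T m (pt x k) = D.T (9 - m) (pt x (k + 24))) :
    IsFusion (fun m k => D.T m (pt x k)) (fun k => D.φ (pt x k)) where
  p_ne := hφ
  p_add k := by
    rw [← D.φ_add_period (pt x k)]
    simp only [pt, period]
    push_cast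
    congr 1
    ring
  T_neg m k hm := D.T_neg hm _
  T_zero k := D.T_zero_pt x k
  T_rec m k hm := by
    lift m to ℕ using (by omega)
    match m, hm with
    -- Up to m = 3 the recursion meets T_0, normalized as f_2, and vanishing T_m of negative index,
    -- so these cases are separate from the uniform one.
    | 1, _ =>
      have p1 := hφ (k - 21)
      have p2 := hφ (k - 7)
      simp only [Nat.cast_one, mul_one, sub_self, Int.reduceSub, D.T_neg (by norm_num : (-1 : ℤ) < 0),
        D.T_neg (by norm_num : (-2 : ℤ) < 0), mul_zero, sub_zero, add_zero, T_zero_pt]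
      rw [show k + 14 - 14 = k by ring, show k + 14 - 35 = k - 21 by ring,
        show k + 14 - 21 = k - 7 by ring, show k - 14 + 7 = k - 7 by ring,
        show k - 14 - 7 = k - 21 by ring]
      field_simp
    | 2, _ =>
      have h := T_rec_two hφ hQ k
      simp only [Nat.cast_ofNat, Int.reduceMul, Int.reduceSub,
        D.T_neg (by norm_num : (-1 : ℤ) < 0), mul_zero, add_zero]
      rw [h, show k + 28 - 14 = k + 14 by ring, show k + 28 - 35 = k - 7 by ring,
        show k + 28 - 21 = k + 7 by ring, show k + 28 - 28 = k by ring,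
        show k + 28 + 7 = k + 35 by ring, show k + 28 - 49 = k - 21 by ring]
    | 3, _ =>
      have h := T_rec_three hφ hQ k
      simp only [Nat.cast_ofNat, Int.reduceMul, Int.reduceSub]
      rw [h, show k + 42 - 14 = k + 28 by ring, show k + 42 - 35 = k + 7 by ring,
        show k + 42 - 21 = k + 21 by ring, show k + 42 - 28 = k + 14 by ring,
        show k + 42 + 7 = k + 49 by ring, show k + 42 - 49 = k - 7 by ring,
        show k + 42 - 7 = k + 35 by ring]
    | n + 4, _ =>
      have h := T_rec_add_four hφ hQ n k _ rfl
      simp only [Nat.cast_add, Nat.cast_ofNat]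
      rw [h, show k + 14 * ((n : ℤ) + 4) = k + 14 * n + 56 by ring,
        show (n : ℤ) + 4 - 1 = n + 3 by ring, show (n : ℤ) + 4 - 2 = n + 2 by ring,
        show (n : ℤ) + 4 - 3 = n + 1 by ring]
      generalize k + 14 * (n : ℤ) = l
      rw [show l + 56 - 14 = l + 42 by ring, show l + 56 - 35 = l + 21 by ring,
        show l + 56 - 21 = l + 35 by ring, show l + 56 - 28 = l + 28 by ring,
        show l + 56 + 7 = l + 63 by ring, show l + 56 - 49 = l + 7 by ring,
        show l + 56 - 7 = l + 49 by ring]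
  dual := hd

/-! ### The skew determinants on the lattice -/

variable (D)

/-- The values of the fusion transfer matrices on the lattice of step `i/14` through `x`. -/
def tq (x : ℂ) (m k : ℤ) : ℂ := D.T m (pt x k)

/-- The values of the vacuum function on the lattice of step `i/14` through `x`. -/
def pq (x : ℂ) (k : ℤ) : ℂ := D.φ (pt x k)

theorem T_pt (x : ℂ) (m k : ℤ) : D.T m (pt x k) = D.tq x m k := rfl

theorem φ_pt (x : ℂ) (k : ℤ) : D.φ (pt x k) = D.pq x k := rfl

theorem T0_pt (x : ℂ) (k : ℤ) : D.T0 (pt x k) = D.tq x 0 k := rfl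

theorem TB2_pt (x : ℂ) (k : ℤ) : D.TB2 (pt x k) = D.tq x 7 k := rfl

theorem pt_zero (x : ℂ) : pt x 0 = x := by simp [pt]

theorem pt_add_I_mul (x : ℂ) (k a : ℤ) : pt x k + I * (a : ℂ) = pt x (k + 14 * a) := by
  simp only [pt]; push_cast; ring

theorem pm_pt (F : ℂ → ℂ) (x : ℂ) (k l : ℤ) (a : ℂ) (h : a = l / 14) :
    pm F (pt x k) a = F (pt x (k + l)) * F (pt x (k - l)) := by
  rw [pm, mul_comm I, pt_add x k l a h, pt_sub x k l a h]

/-- Each unit i in a determinant entry is 14 lattice steps. In the larger determinants below,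
`Ttrunc` removes the entries of index at least 10. -/
theorem Lam_TB3_pt (x : ℂ) (k : ℤ) : D.Lam ![8, 1] ![0, 0] (pt x k) =
    D.tq x 8 (k + 14) * D.tq x 1 (k - 112) - D.tq x 9 k * D.tq x 0 (k - 98) := by
  simp only [Lam, Matrix.det_succ_row_zero, Matrix.of_apply, pt_add_I_mul, Fin.sum_univ_succ,
    Matrix.submatrix_apply]
  simp [Ttrunc, add_assoc, Fin.succAbove, T_pt, sub_eq_add_neg]

theorem Lam_TB5_pt (x : ℂ) (k : ℤ) : D.Lam ![15, 8, 8] ![7, 7, 0] (pt x k) =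
    D.tq x 8 (k + 126) *
      (D.tq x 1 k * D.tq x 8 (k - 126) - D.tq x 9 (k - 112) * D.tq x 0 (k - 14)) -
    D.tq x 9 (k + 112) *
      (D.tq x 0 (k + 14) * D.tq x 8 (k - 126) - D.tq x 9 (k - 112) * D.tq x (-1) k) := by
  simp only [Lam, Matrix.det_succ_row_zero, Matrix.of_apply, pt_add_I_mul, Fin.sum_univ_succ,
    Matrix.submatrix_apply]
  simp [Ttrunc, add_assoc, Fin.succAbove, T_pt, sub_eq_add_neg]

theorem Lam_TB7_pt (x : ℂ) (k : ℤ) : D.Lam ![15, 15, 8, 8] ![14, 7, 7, 0] (pt x k) =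
    D.tq x 1 (k + 238) * (D.tq x 8 (k + 112) *
      (D.tq x 1 (k - 14) * D.tq x 8 (k - 140) - D.tq x 9 (k - 126) * D.tq x 0 (k - 28)) -
        D.tq x 9 (k + 98) *
          (D.tq x 0 k * D.tq x 8 (k - 140) - D.tq x 9 (k - 126) * D.tq x (-1) (k - 14))) -
    D.tq x 9 (k + 126) * (D.tq x 0 (k + 224) *
      (D.tq x 1 (k - 14) * D.tq x 8 (k - 140) - D.tq x 9 (k - 126) * D.tq x 0 (k - 28)) -
        D.tq x 9 (k + 98) *
          (D.tq x (-8) (k + 112) * D.tq x 8 (k - 140) -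
            D.tq x 9 (k - 126) * D.tq x (-9) (k + 98))) := by
  simp only [Lam, Matrix.det_succ_row_zero, Matrix.of_apply, pt_add_I_mul, Fin.sum_univ_succ,
    Matrix.submatrix_apply]
  simp [Ttrunc, add_assoc, Fin.succAbove, T_pt, sub_eq_add_neg]

theorem Lam_T6_pt (x : ℂ) (k : ℤ) : D.Lam ![8, 7] ![6, 0] (pt x k) =
    D.tq x 2 (k + 98) * D.tq x 7 (k - 28) - D.tq x 9 k * D.tq x 0 (k + 70) := by
  simp only [Lam, Matrix.det_succ_row_zero, Matrix.of_apply, pt_add_I_mul, Fin.sum_univ_succ,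
    Matrix.submatrix_apply]
  simp [Ttrunc, add_assoc, Fin.succAbove, T_pt, sub_eq_add_neg]

theorem Lam_node_three_pt (x : ℂ) (k : ℤ) : D.Lam ![12, 8, 7] ![5, 4, 0] (pt x k) =
    D.tq x 7 (k + 98) *
      (D.tq x 4 k * D.tq x 7 (k - 98) - D.tq x 9 (k - 70) * D.tq x 2 (k - 28)) -
    D.tq x 9 (k + 70) *
      (D.tq x 2 (k + 28) * D.tq x 7 (k - 98) - D.tq x 9 (k - 70) * D.tq x 0 k) := by
  simp only [Lam, Matrix.det_succ_row_zero, Matrix.of_apply, pt_add_I_mul, Fin.sum_univ_succ,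
    Matrix.submatrix_apply]
  simp [Ttrunc, add_assoc, Fin.succAbove, T_pt, sub_eq_add_neg]

theorem Lam_node_four_pt (x : ℂ) (k : ℤ) : D.Lam ![5, 1] ![0, 0] (pt x k) =
    D.tq x 5 (k + 14) * D.tq x 1 (k - 70) - D.tq x 6 k * D.tq x 0 (k - 56) := by
  simp only [Lam, Matrix.det_succ_row_zero, Matrix.of_apply, pt_add_I_mul, Fin.sum_univ_succ,
    Matrix.submatrix_apply]
  simp [Ttrunc, add_assoc, Fin.succAbove, T_pt, sub_eq_add_neg]

variable {D} {x : ℂ}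

theorem TB3_pt (H : IsFusion (D.tq x) (D.pq x)) (k : ℤ) :
    D.TB3 (pt x k) = IsFusion.B3 (D.tq x) (D.pq x) k := by
  rw [TB3, pt_add x k 13 _ (by norm_num), pt_sub x k 24 _ (by norm_num), Lam_TB3_pt, φ_pt,
    H.T_dual (m := 8) (n := 1) (l := k + 3) (by norm_num) (by norm_num) (by norm_num) (by omega),
    H.T_dual (m := 9) (n := 0) (l := k - 11) (by norm_num) (by norm_num) (by norm_num) (by omega),
    H.T_mod (m := 1) (k := k + 13 - 112) (l := k - 3) (by norm_num) (by norm_num) (by omega),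
    H.T_mod (m := 0) (k := k + 13 - 98) (l := k + 11) (by norm_num) (by norm_num) (by omega),
    H.p_mod (k := k - 24) (l := k + 24) (by omega), IsFusion.B3]
  ring

theorem TB5_pt (H : IsFusion (D.tq x) (D.pq x)) (k : ℤ) :
    D.TB5 (pt x k) = IsFusion.B5 (D.tq x) (D.pq x) k := by
  rw [TB5, pm_pt _ x k 21 _ (by norm_num), Lam_TB5_pt, φ_pt, φ_pt,
    H.T_dual (m := 8) (n := 1) (k := k + 126) (l := k + 6) (by norm_num) (by norm_num)
      (by norm_num) (by omega),
    H.T_dual (m := 8) (n := 1) (k := k - 126) (l := k - 6) (by norm_num) (by norm_num)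
      (by norm_num) (by omega),
    H.T_dual (m := 9) (n := 0) (k := k - 112) (l := k + 8) (by norm_num) (by norm_num)
      (by norm_num) (by omega),
    H.T_dual (m := 9) (n := 0) (k := k + 112) (l := k - 8) (by norm_num) (by norm_num)
      (by norm_num) (by omega), H.T_neg (-1) _ (by norm_num), IsFusion.B5]
  ring

theorem TB7_pt (H : IsFusion (D.tq x) (D.pq x)) (k : ℤ) :
    D.TB7 (pt x k) = IsFusion.B7 (D.tq x) (D.pq x) k := by
  rw [TB7, pt_add x k 11 _ (by norm_num), pm_pt _ x k 18 _ (by norm_num),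
    pt_sub x k 24 _ (by norm_num), Lam_TB7_pt, φ_pt, φ_pt, φ_pt,
    H.T_mod (m := 1) (k := k + 11 + 238) (l := k + 9) (by norm_num) (by norm_num) (by omega),
    H.T_dual (m := 8) (n := 1) (k := k + 11 + 112) (l := k + 3) (by norm_num) (by norm_num)
      (by norm_num) (by omega),
    H.T_mod (m := 1) (k := k + 11 - 14) (l := k - 3) (by norm_num) (by norm_num) (by omega),
    H.T_dual (m := 8) (n := 1) (k := k + 11 - 140) (l := k - 9) (by norm_num) (by norm_num)
      (by norm_num) (by omega),
    H.T_dual (m := 9) (n := 0) (k := k + 11 - 126) (l := k + 5) (by norm_num) (by norm_num)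
      (by norm_num) (by omega),
    H.T_mod (m := 0) (k := k + 11 - 28) (l := k - 17) (by norm_num) (by norm_num) (by omega),
    H.T_dual (m := 9) (n := 0) (k := k + 11 + 98) (l := k - 11) (by norm_num) (by norm_num)
      (by norm_num) (by omega),
    H.T_dual (m := 9) (n := 0) (k := k + 11 + 126) (l := k + 17) (by norm_num) (by norm_num)
      (by norm_num) (by omega),
    H.T_mod (m := 0) (k := k + 11 + 224) (l := k - 5) (by norm_num) (by norm_num) (by omega),
    H.T_neg (-1) _ (by norm_num), H.T_neg (-8) _ (by norm_num), H.T_neg (-9) _ (by norm_num),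
    H.p_mod (k := k - 24) (l := k + 24) (by omega), IsFusion.B7]
  ring

theorem T6_pt (H : IsFusion (D.tq x) (D.pq x)) (k : ℤ) :
    D.T6 (pt x k) = IsFusion.S6 (D.tq x) k := by
  rw [T6, pt_add x k 25 _ (by norm_num), Lam_T6_pt,
    H.T_dual (m := 2) (n := 7) (l := k + 3) (by norm_num) (by norm_num) (by norm_num) (by omega),
    H.T_mod (m := 7) (k := k + 25 - 28) (l := k - 3) (by norm_num) (by norm_num) (by omega),
    H.T_dual (m := 9) (n := 0) (l := k + 1) (by norm_num) (by norm_num) (by norm_num) (by omega),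
    H.T_mod (m := 0) (k := k + 25 + 70) (l := k - 1) (by norm_num) (by norm_num) (by omega),
    IsFusion.S6]

theorem node_three_pt (H : IsFusion (D.tq x) (D.pq x)) (k : ℤ) :
    D.Lam ![12, 8, 7] ![5, 4, 0] (pt x k) = IsFusion.S3 (D.tq x) k := by
  rw [Lam_node_three_pt,
    H.T_mod (m := 7) (k := k + 98) (l := k + 2) (by norm_num) (by norm_num) (by omega),
    H.T_mod (m := 7) (k := k - 98) (l := k - 2) (by norm_num) (by norm_num) (by omega),
    H.T_dual (m := 9) (n := 0) (k := k - 70) (l := k + 2) (by norm_num) (by norm_num)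
      (by norm_num) (by omega),
    H.T_dual (m := 9) (n := 0) (k := k + 70) (l := k - 2) (by norm_num) (by norm_num)
      (by norm_num) (by omega),
    H.T_dual (m := 2) (n := 7) (k := k - 28) (l := k - 4) (by norm_num) (by norm_num)
      (by norm_num) (by omega),
    H.T_dual (m := 2) (n := 7) (k := k + 28) (l := k + 4) (by norm_num) (by norm_num)
      (by norm_num) (by omega), IsFusion.S3]

theorem node_four_pt (H : IsFusion (D.tq x) (D.pq x)) (k : ℤ) :
    D.Lam ![5, 1] ![0, 0] (pt x k + 15 / 14 * I) / D.φ (pt x k - 13 / 2 * I + 15 / 14 * I) =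
      IsFusion.S4 (D.tq x) (D.pq x) k := by
  rw [pt_add x k 15 _ (by norm_num), pt_sub x k 91 _ (by norm_num),
    pt_add x _ 15 _ (by norm_num), Lam_node_four_pt, φ_pt,
    H.T_dual (m := 5) (n := 4) (l := k + 5) (by norm_num) (by norm_num) (by norm_num) (by omega),
    H.T_mod (m := 1) (k := k + 15 - 70) (l := k - 7) (by norm_num) (by norm_num) (by omega),
    H.T_dual (m := 6) (n := 3) (l := k - 9) (by norm_num) (by norm_num) (by norm_num) (by omega),
    H.T_mod (m := 0) (k := k + 15 - 56) (l := k + 7) (by norm_num) (by norm_num) (by omega),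
    H.p_mod (k := k - 91 + 15) (l := k + 20) (by omega), IsFusion.S4]

/-! ### The solution and its relations off a discrete set -/

variable (D)

/-- The solution of the `D₄` related `T`-system. -/
def solT : Node → ℕ → ℂ → ℂ
  | _, 0 => 1
  | .n1, 1 => D.T6
  | .n2, 1 => D.TB7
  | .n3, 1 => D.Lam ![12, 8, 7] ![5, 4, 0]
  | .n4, 1 => fun x => D.Lam ![5, 1] ![0, 0] (x + 15 / 14 * I) /
      D.φ (x - 13 / 2 * I + 15 / 14 * I)
  | .n1, 2 => fun x => D.TB5 x * pm D.TB2 x (1 / 7)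
  | .n2, 2 => fun x => pm D.TB5 x (1 / 7) * D.TB2 x
  | .n3, 2 => fun x => pm D.TB5 x (1 / 14) * pm D.TB2 x (1 / 14)
  | .n4, 2 => fun x => D.TB5 x * D.TB2 x
  | .n1, 3 => fun x => pm D.TB5 x (1 / 14) * pm D.TB2 x (1 / 14)
  | .n2, 3 => fun x => pm D.TB5 x (1 / 14) * pm D.TB2 x (1 / 14) * D.TB3 x
  | _, _ => 0

/-- The coefficients of the `D₄` related `T`-system. -/
def solG : Node → ℕ → ℂ → ℂ
  | .n1, 1 => D.T0
  | .n1, _ => fun x => pm D.T0 x (1 / 14)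
  | .n2, 1 => fun x => pm D.T0 x (2 / 7)
  | .n2, _ => fun x => pm (fun y => pm D.T0 y (2 / 7)) x (1 / 14)
  | .n3, _ => 1
  | .n4, _ => 1

variable {D}

theorem prod_adj_one (F : Node → ℂ) : ∏ b with Node.Adj b .n1, F b = F .n3 := by
  rw [show Finset.univ.filter (fun b => Node.Adj b .n1) = {.n3} by decide,
    Finset.prod_singleton]

theorem prod_adj_two (F : Node → ℂ) : ∏ b with Node.Adj b .n2, F b = F .n3 := by
  rw [show Finset.univ.filter (fun b => Node.Adj b .n2) = {.n3} by decide,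
    Finset.prod_singleton]

theorem prod_adj_three (F : Node → ℂ) :
    ∏ b with Node.Adj b .n3, F b = F .n1 * F .n2 * F .n4 := by
  rw [show Finset.univ.filter (fun b => Node.Adj b .n3) = {.n1, .n2, .n4} by decide,
    Finset.prod_insert (by decide), Finset.prod_pair (by decide), mul_assoc]

theorem prod_adj_four (F : Node → ℂ) : ∏ b with Node.Adj b .n4, F b = F .n3 := by
  rw [show Finset.univ.filter (fun b => Node.Adj b .n4) = {.n3} by decide,
    Finset.prod_singleton]

theorem tsystem_of_isFusion {x : ℂ} (H : IsFusion (D.tq x) (D.pq x)) (a : Node) (m : ℕ)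
    (hm : m = 1 ∨ m = 2) : pm (D.solT a m) x (1 / 14) =
      D.solT a (m - 1) x * D.solT a (m + 1) x +
        D.solG a m x * ∏ b with Node.Adj b a, D.solT b m x := by
  rw [← pt_zero x, pm_pt _ x 0 1 _ (by norm_num)]
  rcases hm with rfl | rfl <;> rcases a with _ | _ | _ | _ <;>
    simp only [prod_adj_one, prod_adj_two, prod_adj_three, prod_adj_four, solT, solG,
      Nat.reduceAdd, Nat.reduceSub, Pi.one_apply, Pi.zero_apply, one_mul, mul_zero, zero_add,
      node_three_pt H, node_four_pt H, T6_pt H, TB7_pt H]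
  all_goals
    try simp only [pm_pt _ _ _ 1 (1 / 14) (by norm_num), pm_pt _ _ _ 2 (1 / 7) (by norm_num),
      pm_pt _ _ _ 4 (2 / 7) (by norm_num), TB3_pt H, TB5_pt H, TB2_pt, T0_pt, Int.reduceAdd,
      Int.reduceSub, Int.reduceNeg]
  · exact H.S6_mul_S6 0
  · exact H.B7_mul_B7 0
  · exact H.S3_mul_S3 0
  · exact H.S4_mul_S4 0
  -- At level two, nodes 1 and 2 are `T_mul_T` and `B5_mul_B5` times a common factor; at nodes 3 and
  -- 4 truncation leaves two equal products.
  · have h := IsFusion.T_mul_T (T := D.tq x) 0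
    simp only [Int.reduceAdd, Int.reduceSub, Int.reduceNeg] at h
    linear_combination IsFusion.B5 (D.tq x) (D.pq x) 1 * IsFusion.B5 (D.tq x) (D.pq x) (-1) *
      D.tq x 7 1 * D.tq x 7 (-1) * h
  · have h := H.B5_mul_B5 0
    simp only [Int.reduceAdd, Int.reduceSub, Int.reduceNeg] at h
    linear_combination IsFusion.B5 (D.tq x) (D.pq x) 1 * IsFusion.B5 (D.tq x) (D.pq x) (-1) *
      D.tq x 7 1 * D.tq x 7 (-1) * h
  · ring
  · ring

theorem isD4System_of_eventually
    (h : ∀ᶠ x in codiscrete ℂ, ∀ (a : Node) (m : ℕ), m = 1 ∨ m = 2 →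
      pm (D.solT a m) x (1 / 14) = D.solT a (m - 1) x * D.solT a (m + 1) x +
        D.solG a m x * ∏ b with Node.Adj b a, D.solT b m x) :
    IsD4System D.T0 D.TB3 D.solT D.solG where
  zero a := by cases a <;> rfl
  tsystem a m hm := h.mono fun x hx => hx a m hm
  g_two a x := by cases a <;> simp [solG, pm]
  truncation_three := rfl
  truncation_four := rfl
  g_three := rfl
  g_four := rfl
  glue_t_one := rfl
  glue_t_two _ := rfl
  glue_g_one := rfl
  glue_g_two _ := rfl

/-- Off a discrete set the relations between the fusion transfer matrices hold pointwise. -/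
theorem eventually_isFusion (hN : Even D.N) (hτ : 0 < D.τ.im) (hDual : D.IsDual)
    (h0 : ∃ x, D.φ x ≠ 0) : ∀ᶠ x in codiscrete ℂ, IsFusion (D.tq x) (D.pq x) := by
  have hd : ∀ᶠ x in codiscrete ℂ, ∀ m : Fin 11,
      D.T (m : ℕ) x = D.T (9 - (m : ℕ)) (x + I * (period / 2)) :=
    eventually_all.2 fun m => hDual (m : ℕ) (by omega) (by omega)
  have h := (eventually_φ_ne_zero hτ h0).and ((eventually_Q_ne_zero hτ).and hd)
  -- One period of 48 points needs only a finite intersection of codiscrete sets; `hper` carries the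
  -- conditions to the whole lattice.
  have h48 : ∀ᶠ x in codiscrete ℂ, ∀ r : Fin 48, _ :=
    eventually_all.2 fun r => eventually_codiscrete_add h (I * (((r : ℕ) : ℂ) / 14))
  filter_upwards [h48] with x hx
  have hper : ∀ k : ℤ, ∃ r : Fin 48, ∀ F : ℂ → ℂ, (∀ y, F (y + period * I) = F y) →
      F (pt x k) = F (x + I * (((r : ℕ) : ℂ) / 14)) := by
    intro k
    refine ⟨⟨(k % 48).toNat, by omega⟩, fun F hF => ?_⟩
    have hn : ∀ (y : ℂ) (q : ℤ), F (y + q * (period * I)) = F y := by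
      intro y q
      induction q using Int.induction_on generalizing y with
      | zero => simp
      | succ q ih =>
        rw [← (hF (y + ((q : ℤ) : ℂ) * (period * I))).trans (ih y)]; congr 1; push_cast; ring
      | pred q ih => rw [← ih y, ← hF (y + _)]; congr 1; push_cast; ring
    rw [← hn (x + _) (k / 48)]
    congr 1
    have e : (((k % 48).toNat : ℕ) : ℂ) = k - 48 * ((k / 48 : ℤ) : ℂ) := by
      have : (((k % 48).toNat : ℕ) : ℤ) = k - 48 * (k / 48) := by omega
      exact_mod_cast congrArg (Int.cast : ℤ → ℂ) this
    simp only [pt, period, e]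
    ring
  refine isFusion (fun k => ?_) (fun k => ?_) fun m k hm0 hm => ?_
  · obtain ⟨r, hr⟩ := hper k
    rw [hr _ D.φ_add_period]
    exact (hx r).1
  · obtain ⟨r, hr⟩ := hper k
    rw [hr _ (D.Q_add_period hN)]
    exact (hx r).2.1
  · obtain ⟨r, hr⟩ := hper k
    lift m to ℕ using hm0
    have e := (hx r).2.2 ⟨m, by omega⟩
    have e1 := hr _ (D.T_add_period hN m)
    have e2 := hr (fun y => D.T (9 - m) (y + I * (period / 2))) fun y => by
      rw [add_right_comm, D.T_add_period hN]
    rw [e1, show pt x (k + 24) = pt x k + I * (period / 2) by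
      simp only [pt, period]; push_cast; ring]
    exact e.trans e2.symm

/-- Division by zero would make φ vanish identically if h[2i] h[3i] = 0 and N > 0. All relations are
then 0 = 0, so the zeros of ϑ₁ need not be located. -/
theorem T_eq_zero_of_φ_eq_zero (h0 : ∀ x, D.φ x = 0) (m : ℤ) (x : ℂ) : D.T m x = 0 := by
  match m with
  | .ofNat 0 => simp [T, f, pm, h0]
  | .ofNat (m + 1) =>
    have hb : ∀ l y, D.box l y = 0 := by
      intro l y
      fin_cases l <;> simp [box, h0]
    simp [T, rowSum, hb]
  | .negSucc _ => rfl

theorem Lam_eq_zero_of_φ_eq_zero (h0 : ∀ x, D.φ x = 0) {n : ℕ} (μ ν : Fin (n + 1) → ℤ) (x : ℂ) :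
    D.Lam μ ν x = 0 := by
  simp only [Lam, Ttrunc, T_eq_zero_of_φ_eq_zero h0, ite_self]
  exact Matrix.det_eq_zero_of_row_eq_zero 0 fun _ => rfl

theorem tsystem_of_φ_eq_zero (h0 : ∀ x, D.φ x = 0) (x : ℂ) (a : Node) (m : ℕ)
    (hm : m = 1 ∨ m = 2) : pm (D.solT a m) x (1 / 14) =
      D.solT a (m - 1) x * D.solT a (m + 1) x +
        D.solG a m x * ∏ b with Node.Adj b a, D.solT b m x := by
  rcases hm with rfl | rfl <;> rcases a with _ | _ | _ | _ <;>
    simp [prod_adj_one, prod_adj_two, prod_adj_three, prod_adj_four, solT, pm, T6, TB5, TB7, h0,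
      Lam_eq_zero_of_φ_eq_zero h0]

end Data

end DiluteA5

end

open DiluteA5 in
theorem mainTheorem3 (D : Data) (hN : Even D.N) (hτ : 0 < D.τ.im)
    (hBethe : D.IsBethe) (hDual : D.IsDual) :
    ∃ t g : Node → ℕ → ℂ → ℂ,
      IsD4System D.T0 D.TB3 t g ∧
      (∀ x, t .n1 1 x = D.T6 x) ∧
      (∀ x, t .n2 1 x = D.TB7 x) ∧
      (∀ x, t .n3 1 x = D.Lam ![12, 8, 7] ![5, 4, 0] x) ∧
      (∀ x, t .n4 1 x = D.Lam ![5, 1] ![0, 0] (x + 15 / 14 * Complex.I) /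
        D.φ (x - 13 / 2 * Complex.I + 15 / 14 * Complex.I)) ∧
      (∀ x, t .n1 2 x = D.TB5 x * pm D.TB2 x (1 / 7)) ∧
      (∀ x, t .n2 2 x = pm D.TB5 x (1 / 7) * D.TB2 x) ∧
      (∀ x, t .n3 2 x = pm D.TB5 x (1 / 14) * pm D.TB2 x (1 / 14)) ∧
      (∀ x, t .n4 2 x = D.TB5 x * D.TB2 x) := by
  refine ⟨D.solT, D.solG, Data.isD4System_of_eventually ?_, fun _ => rfl, fun _ => rfl,
    fun _ => rfl, fun _ => rfl, fun _ => rfl, fun _ => rfl, fun _ => rfl, fun _ => rfl⟩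
  by_cases h0 : ∃ x, D.φ x ≠ 0
  · filter_upwards [Data.eventually_isFusion hN hτ hDual h0] with x hx a m hm
    exact Data.tsystem_of_isFusion hx a m hm
  · push Not at h0
    exact Filter.Eventually.of_forall fun x a m hm => Data.tsystem_of_φ_eq_zero h0 x a m hm
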